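/- Let $N\ge 1$ and $M>1$ be integers. A *shifted TGL* (triangular Gatzouras–Lalley-type) *system* consists of the maps $$f_i(x)=\begin{pmatrix} b_i&0\\ d_i&a_i\end{pmatrix}x+t_i,\qquad x\in\mathbb R^2,\quad i=1,\dots,N,$$ with $0<a_i<b_i<1$, $d_i\in\mathbb R$, $t_i=(t_{i,1},t_{i,2})\in\mathbb R^2$, together with a partition of $\{1,\dots,N\}$ into $M$ non-empty sets (columns) $\mathcal I_1,\dots,\mathcal I_M$ and numbers $r_j,u_j$ $(1\le j\le M)$, such that * $b_i=r_j$ and $t_{i,1}=u_j$ whenever $i\in\mathcal I_j$; * $\sum_{i\in\mathcal I_j}a_i\le 1$ for every $j$, and $\sum_{j=1}^M r_j\le 1$; * $f_i([0,1]^2)\subseteq[0,1]^2$ for every $i$; * the smallest and the largest fixed point of the maps $h_j(x)=r_jx+u_j$ on $\mathbb R$ are $0$ and $1$ respectively. Its attractor, the unique non-empty compact set $\Lambda\subset\mathbb R^2$ with $\Lambda=\bigcup_i f_i(\Lambda)$, is a *shifted TGL carpet*; let $\Lambda_{\mathcal H}\subset\mathbb R$ be the attractor of $\mathcal H=\{h_1,\dots,h_M\}$.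 Write $\dim_{\rm P}$, $\overline{\dim}_{\rm B}$ and $\dim_{\rm B}$ for packing, upper box and box dimension (the last one when the lower and upper box dimensions agree). The system satisfies the *ROSC* if, with $U=(0,1)^2$, one has $\Lambda\cap U\ne\emptyset$, $\bigcup_i f_i(U)\subseteq U$, and $f_i(U)\cap f_j(U)=\emptyset$ for all $i\ne j$. **Theorem 3.4.** Let $\Lambda$ be a shifted TGL carpet. Then the box dimension $s_{\mathcal H}=\dim_{\rm B}\Lambda_{\mathcal H}$ exists, and there are unique real numbers $\tilde s_x$, $s$ and $s_A$ with $$\sum_{i=1}^N b_i^{\tilde s_x}=1,\qquad \sum_{i=1}^N b_i^{s_{\mathcal H}}a_i^{\,s-s_{\mathcal H}}=1,\qquad \sum_{i=1}^N b_i^{\min\{\tilde s_x,1\}}a_i^{\,s_A-\min\{\tilde s_x,1\}}=1 .$$ Regardless of overlaps, $$\dim_{\rm P}\Lambda=\overline{\dim}_{\rm B}\Lambda\le s\le s_A .$$ If moreover the ROSC holds, then the box dimension of $\Lambda$ exists and $\dim_{\rm P}\Lambda=\dim_{\rm B}\Lambda=s$. -/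

import Mathlib

open Set Filter Topology
open scoped ENNReal NNReal

noncomputable section

namespace TGL

/-! ### Box dimension -/

/-- The quotient `log N_δ(F) / (-log δ)`, where `N_δ(F)` is the smallest number of closed balls of
radius `δ` that cover `F`. -/
def boxRatio {X : Type*} [PseudoEMetricSpace X] (F : Set X) (δ : ℝ≥0) : EReal :=
  ENNReal.log (Metric.externalCoveringNumber δ F : ℝ≥0∞) / ((-Real.log (δ : ℝ) : ℝ) : EReal)

/-- Upper box (counting) dimension: the limsup of `log N_δ(F) / (-log δ)` as `δ → 0+`. -/
def upperBoxDim {X : Type*} [PseudoEMetricSpace X] (F : Set X) : EReal :=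
  limsup (boxRatio F) (𝓝[>] (0 : ℝ≥0))

/-- Lower box (counting) dimension: the liminf of `log N_δ(F) / (-log δ)` as `δ → 0+`. -/
def lowerBoxDim {X : Type*} [PseudoEMetricSpace X] (F : Set X) : EReal :=
  liminf (boxRatio F) (𝓝[>] (0 : ℝ≥0))

/-- The box dimension of `F` exists and equals `s`. -/
def HasBoxDim {X : Type*} [PseudoEMetricSpace X] (F : Set X) (s : ℝ) : Prop :=
  lowerBoxDim F = (s : EReal) ∧ upperBoxDim F = (s : EReal)

/-! ### Packing measures and packing dimension -/

/-- `P` is a finite packing of `F` at scale `δ`: a finite collection of pairwise disjoint closed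
balls (given by centre and radius) with centres in `F` and radii in `(0, δ]`. -/
def IsPacking {X : Type*} [PseudoMetricSpace X] (F : Set X) (δ : ℝ) (P : Finset (X × ℝ)) : Prop :=
  (∀ p ∈ P, p.1 ∈ F ∧ 0 < p.2 ∧ p.2 ≤ δ) ∧
    (P : Set (X × ℝ)).PairwiseDisjoint fun p => Metric.closedBall p.1 p.2

/-- The supremum of `∑ |B|^s` over the packings of `F` by balls `B` of radius at most `δ`; a ball of
radius `r` counts with `|B| = 2 r`. (All sums being of nonnegative terms, the supremum over finite
packings equals the one over arbitrary packings.) -/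
def packingSup {X : Type*} [PseudoMetricSpace X] (s δ : ℝ) (F : Set X) : ℝ≥0∞ :=
  ⨆ (P : Finset (X × ℝ)) (_ : IsPacking F δ P), ∑ p ∈ P, ENNReal.ofReal (2 * p.2) ^ s

/-- The `s`-dimensional packing premeasure: the limit of `packingSup s δ F` as `δ` decreases to
`0`, which is the infimum over `δ > 0`. -/
def packingPremeasure {X : Type*} [PseudoMetricSpace X] (s : ℝ) (F : Set X) : ℝ≥0∞ :=
  ⨅ (δ : ℝ) (_ : 0 < δ), packingSup s δ F

/-- The `s`-dimensional packing measure: the infimum of the sums of the premeasures over all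
countable covers. -/
def packingMeasure {X : Type*} [PseudoMetricSpace X] (s : ℝ) (F : Set X) : ℝ≥0∞ :=
  ⨅ (E : ℕ → Set X) (_ : F ⊆ ⋃ n, E n), ∑' n, packingPremeasure s (E n)

/-- The packing dimension: the supremum of the `s ≥ 0` whose packing measure is infinite. -/
def packingDim {X : Type*} [PseudoMetricSpace X] (F : Set X) : ℝ≥0∞ :=
  ⨆ (s : ℝ≥0) (_ : packingMeasure (s : ℝ) F = ∞), (s : ℝ≥0∞)

/-! ### Iterated function systems and carpets -/

/-- `Λ` is the attractor of the iterated function system `f`: nonempty, compact and equal to the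
union of its images under the maps. -/
def IsAttractor {ι X : Type*} [TopologicalSpace X] (f : ι → X → X) (Λ : Set X) : Prop :=
  Λ.Nonempty ∧ IsCompact Λ ∧ Λ = ⋃ i, f i '' Λ

/-- The Euclidean plane. -/
abbrev Plane : Type := EuclideanSpace ℝ (Fin 2)

/-- The closed unit square `[0,1]²`. -/
def unitSquare : Set Plane := {x | ∀ k, x k ∈ Icc (0 : ℝ) 1}

/-- The open unit square `(0,1)²`. -/
def openSquare : Set Plane := {x | ∀ k, x k ∈ Ioo (0 : ℝ) 1}

/-- The planar affine map with lower triangular linear part `(b 0; d a)` and translation `t`. -/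
def triMap (a b d : ℝ) (t : Plane) (x : Plane) : Plane :=
  !₂[b * x 0 + t 0, d * x 0 + a * x 1 + t 1]

/-- A shifted triangular Gatzouras--Lalley-type iterated function system with `N` maps in `M`
columns. -/
structure ShiftedTGL (N M : ℕ) where
  /-- heights (lower right entries) -/
  a : Fin N → ℝ
  /-- widths (upper left entries) -/
  b : Fin N → ℝ
  /-- off-diagonal entries -/
  d : Fin N → ℝ
  /-- translations -/
  t : Fin N → Plane
  /-- the column to which a map belongs -/
  column : Fin N → Fin M
  /-- column widths -/
  r : Fin M → ℝ
  /-- horizontal translations of the columns -/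
  u : Fin M → ℝ
  /-- direction `x` dominates -/
  a_pos : ∀ i, 0 < a i
  a_lt_b : ∀ i, a i < b i
  b_lt_one : ∀ i, b i < 1
  /-- there are at least two columns, and none is empty -/
  one_lt_M : 1 < M
  column_surjective : Function.Surjective column
  /-- maps in the same column have the same width and the same horizontal translation -/
  b_eq : ∀ i, b i = r (column i)
  t_eq : ∀ i, t i 0 = u (column i)
  /-- the heights in each column add up to at most one -/
  sum_a_le_one : ∀ j, ∑ i with column i = j, a i ≤ 1
  /-- the widths of the columns add up to at most one -/
  sum_r_le_one : ∑ j, r j ≤ 1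
  /-- every map sends the closed unit square into itself -/
  mapsTo_unitSquare : ∀ i, MapsTo (triMap (a i) (b i) (d i) (t i)) unitSquare unitSquare
  /-- the smallest and the largest fixed point of the column maps are `0` and `1` -/
  isLeast_fixedPoint : IsLeast {x : ℝ | ∃ j, r j * x + u j = x} 0
  isGreatest_fixedPoint : IsGreatest {x : ℝ | ∃ j, r j * x + u j = x} 1

namespace ShiftedTGL

variable {N M : ℕ}

/-- The planar iterated function system `f_i(x) = A_i x + t_i`. -/
def map (F : ShiftedTGL N M) (i : Fin N) : Plane → Plane :=
  triMap (F.a i) (F.b i) (F.d i) (F.t i)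

/-- The self-similar system on the line generated by the columns, i.e. the projection of the planar
system to the horizontal axis. -/
def columnMap (F : ShiftedTGL N M) (j : Fin M) (x : ℝ) : ℝ :=
  F.r j * x + F.u j

/-- The rectangular open set condition, for a system with attractor `Λ`. -/
def ROSC (F : ShiftedTGL N M) (Λ : Set Plane) : Prop :=
  (Λ ∩ openSquare).Nonempty ∧ (⋃ i, F.map i '' openSquare) ⊆ openSquare ∧
    ∀ i j, i ≠ j → Disjoint (F.map i '' openSquare) (F.map j '' openSquare)

end ShiftedTGL

end TGL

end

/-!
The map `f_w` of a word `w` is triangular with diagonal entries `b_w > a_w`, the products of those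
of its letters, and its off-diagonal entry is bounded by a constant times `b_w - a_w`. So a cylinder
of height `a_w ≈ δ` is a copy of the carpet squeezed into a strip of height about `δ` and width
`b_w`, and at scale `δ` it looks like the attractor of the column system at scale `δ / b_w`: it
needs about `(b_w / δ) ^ sH` balls of radius `δ`. Since `a_w ≈ δ`, this number is about
`δ ^ (-s)` times the weight `b_w ^ sH * a_w ^ (s - sH)`, and these weights add up to one over the
cylinders of height about `δ`.

*The column system.* Its attractor is self-similar on the line, possibly with overlaps. Its numbers
of `δ`-separated points are supermultiplicative in `δ` up to a constant
(`IsAttractor.sep_mul_sep_le`), and a multiplicative Fekete lemma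
(`exists_powerLaw_of_supermultiplicative`) turns this into a power law, so the box dimension `sH`
exists.

*Upper bound.* Summing over the cylinders of height about `δ` gives `upperBoxDim Λ ≤ s`
(`ShiftedTGL.upperBoxDim_le`). No stopping set of words is ever formed: `tree_induction` carries
estimates from the words stopped at scale `δ` to the empty word. Comparing sums over cylinders of
width about `δ` shows `sH ≤ min sx 1`, whence `s ≤ sA` because `a_i < b_i`.

*Lower bound.* Under the rectangular open set condition the cells, which are the images of the open
square, are disjoint within each generation, and a ball of radius `δ` can meet only boundedly many
cylinders of height about `δ`, by comparing areas. This is carried out with a measure on the plane,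
the sum of Lebesgue measure over squares around the centres of a minimal cover, which is
superadditive along the tree of cells (`ShiftedTGL.ROSC.le_lowerBoxDim`).

*Packing dimension.* It never exceeds the upper box dimension. Conversely every open piece of the
carpet contains an affine copy of it, so by Baire's theorem a countable cover by sets of finite
packing premeasure controls the upper box dimension of the whole carpet
(`packingDim_eq_upperBoxDim`).
-/

/-! ### Counting separated points and covering balls -/

namespace TGL

/-- The largest number of points of `F` with mutual distances greater than `δ`, as an extended
nonnegative real; the scale is a real number (meant to be nonnegative). -/
noncomputable def sep {X : Type*} [PseudoMetricSpace X] (δ : ℝ) (F : Set X) : ℝ≥0∞ :=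
  (Metric.packingNumber δ.toNNReal F : ℝ≥0∞)

/-- The smallest number of closed balls of radius `δ` covering `F`, as an extended nonnegative
real; the scale is a real number (meant to be nonnegative). -/
noncomputable def cov {X : Type*} [PseudoMetricSpace X] (δ : ℝ) (F : Set X) : ℝ≥0∞ :=
  (Metric.externalCoveringNumber δ.toNNReal F : ℝ≥0∞)

section Counting

variable {X Y : Type*} [PseudoMetricSpace X] [PseudoMetricSpace Y] {F G : Set X} {δ : ℝ}

lemma isSeparated_toNNReal_iff (hδ : 0 ≤ δ) {C : Set X} :
    Metric.IsSeparated (δ.toNNReal : ℝ≥0∞) C ↔ C.Pairwise fun x y => δ < dist x y := by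
  unfold Metric.IsSeparated
  simp only [edist_dist]
  have : ∀ x y : X, (δ.toNNReal : ℝ≥0∞) < ENNReal.ofReal (dist x y) ↔ δ < dist x y := fun x y =>
    ENNReal.ofReal_lt_ofReal_iff_of_nonneg hδ
  simp only [this]

lemma card_le_sep (hδ : 0 ≤ δ) (T : Finset X) (hT : (T : Set X) ⊆ F)
    (h : (T : Set X).Pairwise fun x y => δ < dist x y) : (T.card : ℝ≥0∞) ≤ sep δ F := by
  have := Metric.IsSeparated.encard_le_packingNumber hT ((isSeparated_toNNReal_iff hδ).2 h)
  rw [Set.encard_coe_eq_coe_finsetCard] at this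
  have h2 := ENat.toENNReal_le.2 this
  simpa [sep] using h2

lemma sep_le (hδ : 0 ≤ δ) {K : ℝ≥0∞}
    (h : ∀ T : Finset X, (T : Set X) ⊆ F → (T : Set X).Pairwise (fun x y => δ < dist x y) →
      (T.card : ℝ≥0∞) ≤ K) : sep δ F ≤ K := by
  unfold sep Metric.packingNumber
  simp only [ENat.toENNReal_iSup]
  refine iSup_le fun C => iSup_le fun hC => iSup_le fun hs => ?_
  rw [isSeparated_toNNReal_iff hδ] at hs
  rcases C.finite_or_infinite with hf | hi
  · have := h hf.toFinset (by simpa using hC) (by simpa using hs)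
    rw [hf.encard_eq_coe_toFinset_card]
    simpa using this
  · have : K = ∞ := by
      refine ENNReal.eq_top_of_forall_nnreal_le fun r => ?_
      obtain ⟨n, hn⟩ := exists_nat_ge r
      obtain ⟨T, hT, hc⟩ := hi.exists_subset_card_eq n
      have := h T (hT.trans hC) (hs.mono hT)
      rw [hc] at this
      exact le_trans (by exact_mod_cast hn) this
    simp [this]

lemma exists_finset_card_eq_sep (hδ : 0 ≤ δ) (h : sep δ F ≠ ∞) :
    ∃ T : Finset X, (T : Set X) ⊆ F ∧ (T : Set X).Pairwise (fun x y => δ < dist x y) ∧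
      (T.card : ℝ≥0∞) = sep δ F := by
  have h' : Metric.packingNumber δ.toNNReal F ≠ ⊤ := by
    intro h'; exact h (by simp [sep, h'])
  obtain ⟨C, hC, hf, hs, hc⟩ := Metric.exists_set_encard_eq_packingNumber h'
  refine ⟨hf.toFinset, by simpa using hC, by simpa using (isSeparated_toNNReal_iff hδ).1 hs, ?_⟩
  rw [hf.encard_eq_coe_toFinset_card] at hc
  rw [sep, ← hc]; simp

lemma cov_le_sep : cov δ F ≤ sep δ F :=
  ENat.toENNReal_le.2 ((Metric.externalCoveringNumber_le_coveringNumber _ _).trans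
    (Metric.coveringNumber_le_packingNumber _ _))

lemma sep_two_mul_le_cov : sep (2 * δ) F ≤ cov δ F := by
  have := Metric.packingNumber_two_mul_le_externalCoveringNumber δ.toNNReal F
  have h2 : (2 * δ).toNNReal = 2 * δ.toNNReal := by
    rw [Real.toNNReal_mul (by norm_num)]; simp
  rw [sep, h2]
  exact ENat.toENNReal_le.2 this

lemma one_le_cov (h : F.Nonempty) : 1 ≤ cov δ F := by
  have : 0 < Metric.externalCoveringNumber δ.toNNReal F :=
    Metric.externalCoveringNumber_pos_iff.2 h
  have h1 := ENat.toENNReal_le.2 (Order.one_le_iff_pos.2 this)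
  simpa [cov] using h1

lemma cov_le_card (hδ : 0 ≤ δ) (S : Finset X) (h : F ⊆ ⋃ x ∈ S, Metric.closedBall x δ) :
    cov δ F ≤ S.card := by
  have hS : Metric.IsCover δ.toNNReal F (S : Set X) := by
    rw [Metric.isCover_iff_subset_iUnion_closedBall]
    simpa [Real.coe_toNNReal _ hδ] using h
  have := ENat.toENNReal_le.2 hS.externalCoveringNumber_le_encard
  rw [Set.encard_coe_eq_coe_finsetCard] at this
  simpa [cov] using this

lemma exists_finset_card_eq_cov (hδ : 0 ≤ δ) (h : cov δ F ≠ ∞) :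
    ∃ S : Finset X, F ⊆ (⋃ x ∈ S, Metric.closedBall x δ) ∧ (S.card : ℝ≥0∞) = cov δ F := by
  have h' : Metric.externalCoveringNumber δ.toNNReal F ≠ ⊤ := by
    intro h'; exact h (by simp [cov, h'])
  have hne : Nonempty {C : Set X // Metric.IsCover δ.toNNReal F C} :=
    ⟨⟨F, Metric.IsCover.rfl⟩⟩
  obtain ⟨⟨C, hC⟩, hc⟩ := ENat.exists_eq_iInf
    (fun C : {C : Set X // Metric.IsCover δ.toNNReal F C} => C.1.encard)
  have hc' : C.encard = Metric.externalCoveringNumber δ.toNNReal F := by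
    rw [Metric.externalCoveringNumber, iInf_subtype', ← hc]
  have hf : C.Finite := by
    rw [← Set.encard_ne_top_iff, hc']; exact h'
  refine ⟨hf.toFinset, ?_, ?_⟩
  · rw [Metric.isCover_iff_subset_iUnion_closedBall, Real.coe_toNNReal _ hδ] at hC
    simpa using hC
  · rw [hf.encard_eq_coe_toFinset_card] at hc'
    rw [cov, ← hc']; simp

lemma cov_closure_le (hδ : 0 ≤ δ) : cov δ (closure F) ≤ cov δ F := by
  by_cases h : cov δ F = ∞
  · simp [h]
  obtain ⟨S, hS, hc⟩ := exists_finset_card_eq_cov hδ h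
  rw [← hc]
  refine cov_le_card hδ S (closure_minimal hS ?_)
  exact S.finite_toSet.isClosed_biUnion fun x _ => Metric.isClosed_closedBall

/-- A map that sends `δ`-separated pairs of `F` to `ε`-separated pairs of `G` bounds the number of
separated points of `F` by that of `G`. -/
lemma sep_le_sep_of_map {G : Set Y} {ε : ℝ} (hδ : 0 ≤ δ) (hε : 0 ≤ ε) (g : X → Y)
    (hg : MapsTo g F G) (h : ∀ x ∈ F, ∀ y ∈ F, δ < dist x y → ε < dist (g x) (g y)) :
    sep δ F ≤ sep ε G := by
  classical
  refine sep_le hδ fun T hT hs => ?_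
  have hlt : ∀ x ∈ T, ∀ y ∈ T, x ≠ y → ε < dist (g x) (g y) := fun x hx y hy hxy =>
    h x (hT hx) y (hT hy) (hs hx hy hxy)
  have hinj : Set.InjOn g T := by
    intro x hx y hy hxy
    by_contra hne
    have := hlt x hx y hy hne
    rw [hxy] at this
    linarith [dist_nonneg (x := g y) (y := g y), dist_self (g y)]
  rw [← Finset.card_image_of_injOn hinj]
  refine card_le_sep hε _ ?_ ?_
  · intro y hy
    obtain ⟨x, hx, rfl⟩ := by simpa using hy
    exact hg (hT hx)
  · intro y hy z hz hyz
    obtain ⟨x, hx, rfl⟩ := by simpa using hy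
    obtain ⟨x', hx', rfl⟩ := by simpa using hz
    exact hlt x hx x' hx' fun h => hyz (by rw [h])

lemma sep_iUnion_le {ι : Type*} [Fintype ι] (hδ : 0 ≤ δ) (A : ι → Set X) :
    sep δ (⋃ i, A i) ≤ ∑ i, sep δ (A i) := by
  classical
  refine sep_le hδ fun T hT hs => ?_
  have hsub : T ⊆ Finset.univ.biUnion fun i => T.filter fun x => x ∈ A i := by
    intro x hx
    obtain ⟨i, hi⟩ := mem_iUnion.1 (hT hx)
    simp [hx]
    exact ⟨i, hi⟩
  calc (T.card : ℝ≥0∞) ≤ ((∑ i, (T.filter fun x => x ∈ A i).card : ℕ) : ℝ≥0∞) := by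
        exact_mod_cast (Finset.card_le_card hsub).trans Finset.card_biUnion_le
    _ = ∑ i, ((T.filter fun x => x ∈ A i).card : ℝ≥0∞) := by push_cast; rfl
    _ ≤ ∑ i, sep δ (A i) := Finset.sum_le_sum fun i _ =>
        card_le_sep hδ _ (fun x hx => by simpa using (Finset.mem_filter.1 hx).2)
          (hs.mono fun x hx => (Finset.mem_filter.1 hx).1)

end Counting

/-! ### Box dimension and power laws for covering numbers -/

section BoxDim

variable {X : Type*} [PseudoMetricSpace X] {F : Set X}

lemma boxRatio_eq (F : Set X) (δ : ℝ≥0) :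
    boxRatio F δ = ENNReal.log (cov (δ : ℝ) F) / ((-Real.log (δ : ℝ) : ℝ) : EReal) := by
  simp [boxRatio, cov]

lemma log_ofReal_rpow_neg {δ : ℝ} (h0 : 0 < δ) (x : ℝ) :
    ENNReal.log (ENNReal.ofReal (δ ^ (-x))) = (x : EReal) * ((-Real.log δ : ℝ) : EReal) := by
  rw [ENNReal.log_ofReal_of_pos (Real.rpow_pos_of_pos h0 _), Real.log_rpow h0,
    ← EReal.coe_mul]
  congr 1; ring

lemma boxRatio_le_iff {δ : ℝ≥0} (h0 : 0 < δ) (h1 : δ < 1) (x : ℝ) :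
    boxRatio F δ ≤ x ↔ cov (δ : ℝ) F ≤ ENNReal.ofReal ((δ : ℝ) ^ (-x)) := by
  have hl : 0 < -Real.log (δ : ℝ) := by
    have := Real.log_neg (NNReal.coe_pos.2 h0) (by exact_mod_cast h1)
    linarith
  rw [boxRatio_eq, EReal.div_le_iff_le_mul (by exact_mod_cast hl) (EReal.coe_ne_top _),
    ← ENNReal.log_le_log_iff, log_ofReal_rpow_neg (NNReal.coe_pos.2 h0), mul_comm]

lemma le_boxRatio_iff {δ : ℝ≥0} (h0 : 0 < δ) (h1 : δ < 1) (x : ℝ) :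
    (x : EReal) ≤ boxRatio F δ ↔ ENNReal.ofReal ((δ : ℝ) ^ (-x)) ≤ cov (δ : ℝ) F := by
  have hl : 0 < -Real.log (δ : ℝ) := by
    have := Real.log_neg (NNReal.coe_pos.2 h0) (by exact_mod_cast h1)
    linarith
  rw [boxRatio_eq, EReal.le_div_iff_mul_le (by exact_mod_cast hl) (EReal.coe_ne_top _),
    ← ENNReal.log_le_log_iff, log_ofReal_rpow_neg (NNReal.coe_pos.2 h0)]

lemma eventually_nnreal_of_real {p : ℝ → Prop} (h : ∀ᶠ δ in 𝓝[>] (0 : ℝ), p δ) :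
    ∀ᶠ δ : ℝ≥0 in 𝓝[>] (0 : ℝ≥0), p δ := by
  have : Tendsto (fun δ : ℝ≥0 => (δ : ℝ)) (𝓝[>] 0) (𝓝[>] 0) := by
    refine tendsto_nhdsWithin_of_tendsto_nhds_of_eventually_within _ ?_ ?_
    · have := (NNReal.continuous_coe.tendsto (0 : ℝ≥0))
      exact this.mono_left nhdsWithin_le_nhds
    · filter_upwards [self_mem_nhdsWithin] with δ hδ
      exact NNReal.coe_pos.2 hδ
  exact this.eventually h

lemma eventually_mul_rpow_le_one (A : ℝ) {y : ℝ} (hy : 0 < y) :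
    ∀ᶠ δ in 𝓝[>] (0 : ℝ), A * δ ^ y ≤ 1 := by
  have h1 : Tendsto (fun δ : ℝ => A * δ ^ y) (𝓝 0) (𝓝 (A * 0 ^ y)) :=
    ((Real.continuousAt_rpow_const 0 y (Or.inr hy.le)).tendsto).const_mul A
  rw [Real.zero_rpow hy.ne', mul_zero] at h1
  exact (h1.mono_left nhdsWithin_le_nhds).eventually (Iic_mem_nhds one_pos)

lemma upperBoxDim_le_of_cov_le {k C x : ℝ} (hk : 0 < k)
    (h : ∀ δ ∈ Ioo (0 : ℝ) 1, cov (k * δ) F ≤ ENNReal.ofReal (C * δ ^ (-x))) :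
    upperBoxDim F ≤ x := by
  refine EReal.le_of_forall_lt_iff_le.1 fun z hz => ?_
  have hz' : 0 < z - x := sub_pos.2 (by exact_mod_cast hz)
  refine limsup_le_of_le (by isBoundedDefault) ?_
  have ev : ∀ᶠ δ in 𝓝[>] (0 : ℝ), 0 < δ ∧ δ < 1 ∧ δ < k ∧ (C * k ^ x) * δ ^ (z - x) ≤ 1 := by
    filter_upwards [self_mem_nhdsWithin, Ioo_mem_nhdsGT one_pos, Ioo_mem_nhdsGT hk,
      eventually_mul_rpow_le_one (C * k ^ x) hz'] with δ h0 h1 h2 h3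
    exact ⟨h0, h1.2, h2.2, h3⟩
  filter_upwards [eventually_nnreal_of_real ev] with δ ⟨h0, h1, h2, h3⟩
  rw [boxRatio_le_iff (by exact_mod_cast h0) (by exact_mod_cast h1)]
  have := h ((δ : ℝ) / k) ⟨by positivity, (div_lt_one hk).2 h2⟩
  rw [mul_div_cancel₀ _ hk.ne'] at this
  refine this.trans (ENNReal.ofReal_le_ofReal ?_)
  have e1 : C * ((δ : ℝ) / k) ^ (-x) = (C * k ^ x * (δ : ℝ) ^ (z - x)) * (δ : ℝ) ^ (-z) := by
    rw [Real.div_rpow h0.le hk.le, Real.rpow_neg hk.le, div_inv_eq_mul, mul_assoc (C * k ^ x),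
      ← Real.rpow_add h0]
    ring_nf
  rw [e1]
  exact mul_le_of_le_one_left (Real.rpow_nonneg h0.le _) h3

lemma le_lowerBoxDim_of_le_cov {k c x : ℝ} (hk : 0 < k) (hc : 0 < c)
    (h : ∀ δ ∈ Ioo (0 : ℝ) 1, ENNReal.ofReal (c * δ ^ (-x)) ≤ cov (k * δ) F) :
    (x : EReal) ≤ lowerBoxDim F := by
  refine EReal.ge_of_forall_gt_iff_ge.1 fun z hz => ?_
  have hz' : 0 < x - z := sub_pos.2 (by exact_mod_cast hz)
  refine le_liminf_of_le (by isBoundedDefault) ?_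
  have ev : ∀ᶠ δ in 𝓝[>] (0 : ℝ),
      0 < δ ∧ δ < 1 ∧ δ < k ∧ (c * k ^ x)⁻¹ * δ ^ (x - z) ≤ 1 := by
    filter_upwards [self_mem_nhdsWithin, Ioo_mem_nhdsGT one_pos, Ioo_mem_nhdsGT hk,
      eventually_mul_rpow_le_one (c * k ^ x)⁻¹ hz'] with δ h0 h1 h2 h3
    exact ⟨h0, h1.2, h2.2, h3⟩
  filter_upwards [eventually_nnreal_of_real ev] with δ ⟨h0, h1, h2, h3⟩
  rw [le_boxRatio_iff (by exact_mod_cast h0) (by exact_mod_cast h1)]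
  have := h ((δ : ℝ) / k) ⟨by positivity, (div_lt_one hk).2 h2⟩
  rw [mul_div_cancel₀ _ hk.ne'] at this
  refine le_trans (ENNReal.ofReal_le_ofReal ?_) this
  have hck : 0 < c * k ^ x := by positivity
  have e1 : c * ((δ : ℝ) / k) ^ (-x) = (c * k ^ x) * (δ : ℝ) ^ (-x) := by
    rw [Real.div_rpow h0.le hk.le, Real.rpow_neg hk.le, div_inv_eq_mul]
    ring
  have e2 : (δ : ℝ) ^ (-z) = (δ : ℝ) ^ (x - z) * (δ : ℝ) ^ (-x) := by
    rw [← Real.rpow_add h0]; ring_nf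
  rw [e1, e2]
  refine mul_le_mul_of_nonneg_right ?_ (Real.rpow_nonneg h0.le _)
  rwa [inv_mul_le_iff₀ hck, mul_one] at h3

lemma eventually_cov_le_of_upperBoxDim_lt {t : ℝ} (h : upperBoxDim F < t) :
    ∃ δ₀ > 0, ∀ δ : ℝ, 0 < δ → δ ≤ δ₀ → cov δ F ≤ ENNReal.ofReal (δ ^ (-t)) := by
  have h1 := eventually_lt_of_limsup_lt h (by isBoundedDefault)
  have h2 : ∀ᶠ δ : ℝ≥0 in 𝓝[>] 0, cov (δ : ℝ) F ≤ ENNReal.ofReal ((δ : ℝ) ^ (-t)) := by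
    filter_upwards [h1, Ioo_mem_nhdsGT one_pos] with δ hδ h01
    exact (boxRatio_le_iff h01.1 h01.2 t).1 hδ.le
  obtain ⟨u, hu, hsub⟩ := (mem_nhdsGT_iff_exists_Ioc_subset (a := (0 : ℝ≥0))).1 h2
  refine ⟨u, NNReal.coe_pos.2 hu, fun δ h0 hδ => ?_⟩
  exact hsub (show (⟨δ, h0.le⟩ : ℝ≥0) ∈ Ioc 0 u from ⟨h0, hδ⟩)

lemma lowerBoxDim_le_upperBoxDim (F : Set X) : lowerBoxDim F ≤ upperBoxDim F :=
  liminf_le_limsup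

end BoxDim

end TGL

/-! ### Packing dimension and upper box dimension -/

namespace TGL

section Packing

variable {X : Type*} [PseudoMetricSpace X] {F : Set X}

lemma upperBoxDim_nonneg (hF : F.Nonempty) : 0 ≤ upperBoxDim F := by
  refine le_trans ?_ (lowerBoxDim_le_upperBoxDim F)
  have := le_lowerBoxDim_of_le_cov (F := F) (k := 1) (c := 1) (x := 0) one_pos one_pos
    (fun δ _ => by simpa using one_le_cov hF)
  simpa using this

lemma packingPremeasure_empty (s : ℝ) : packingPremeasure s (∅ : Set X) = 0 := by
  refine le_antisymm (iInf₂_le_of_le 1 one_pos ?_) zero_le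
  refine iSup₂_le fun P hP => ?_
  have : P = ∅ := Finset.eq_empty_of_forall_notMem fun p hp => (hP.1 p hp).1
  simp [this]

lemma packingMeasure_le_packingPremeasure (s : ℝ) (F : Set X) :
    packingMeasure s F ≤ packingPremeasure s F := by
  refine iInf₂_le_of_le (fun n => if n = 0 then F else ∅) ?_ ?_
  · intro x hx
    exact mem_iUnion.2 ⟨0, by simpa using hx⟩
  · rw [tsum_eq_single 0]
    · simp
    · intro n hn
      simp [hn, packingPremeasure_empty]

/-- Balls of a packing whose radii exceed `ρ` have `ρ`-separated centres, so there are at most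
`sep ρ F` of them. -/
lemma IsPacking.card_le_sep {δ ρ : ℝ} (hρ : 0 ≤ ρ) {P T : Finset (X × ℝ)} (hP : IsPacking F δ P)
    (hT : T ⊆ P) (hr : ∀ p ∈ T, ρ < p.2) : (T.card : ℝ≥0∞) ≤ sep ρ F := by
  classical
  have key : ∀ p ∈ T, ∀ q ∈ T, p ≠ q → ρ < dist p.1 q.1 := by
    intro p hp q hq hpq
    have hd := hP.2 (hT hp) (hT hq) hpq
    by_contra! hle
    have h1 : p.1 ∈ Metric.closedBall p.1 p.2 :=
      Metric.mem_closedBall_self (hP.1 p (hT hp)).2.1.le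
    have h2 : p.1 ∈ Metric.closedBall q.1 q.2 :=
      Metric.mem_closedBall.2 (hle.trans (hr q hq).le)
    exact Set.disjoint_left.1 hd h1 h2
  have hinj : Set.InjOn Prod.fst (T : Set (X × ℝ)) := by
    intro p hp q hq hpq
    by_contra hne
    have := key p hp q hq hne
    rw [hpq, dist_self] at this
    linarith
  rw [← Finset.card_image_of_injOn hinj]
  refine TGL.card_le_sep hρ _ ?_ ?_
  · intro x hx
    obtain ⟨p, hp, rfl⟩ := Finset.mem_image.1 (Finset.mem_coe.1 hx)
    exact (hP.1 p (hT hp)).1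
  · intro x hx y hy hxy
    obtain ⟨p, hp, rfl⟩ := Finset.mem_image.1 (Finset.mem_coe.1 hx)
    obtain ⟨q, hq, rfl⟩ := Finset.mem_image.1 (Finset.mem_coe.1 hy)
    exact key p hp q hq fun h => hxy (by rw [h])

/-- Above the upper box dimension the packing measure is finite: sort the balls of a packing by the
dyadic size of their radii and sum a geometric series. -/
lemma packingMeasure_ne_top_of_upperBoxDim_lt {s t : ℝ} (hs : 0 ≤ s) (hts : t < s)
    (h : upperBoxDim F < t) : packingMeasure s F ≠ ∞ := by
  classical
  obtain ⟨δ, hδ, hcov⟩ := eventually_cov_le_of_upperBoxDim_lt h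
  set ρ : ℕ → ℝ := fun k => δ * (1 / 2) ^ k with hρ
  have hρ0 : ∀ k, 0 < ρ k := fun k => by positivity
  set q : ℝ := (1 / 2 : ℝ) ^ (s - t) with hq
  have hq0 : 0 ≤ q := by positivity
  have hq1 : q < 1 := Real.rpow_lt_one (by norm_num) (by norm_num) (sub_pos.2 hts)
  set A : ℝ := (δ / 4) ^ (-t) * (2 * δ) ^ s with hA
  have hC : ∀ k, (ρ (k + 2)) ^ (-t) * (2 * ρ k) ^ s = A * q ^ k := by
    intro k
    have e0 : (0 : ℝ) < (1 / 2) ^ k := by positivity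
    have e1 : ρ (k + 2) = δ / 4 * (1 / 2) ^ k := by simp only [hρ]; ring
    have e2 : 2 * ρ k = 2 * δ * (1 / 2) ^ k := by simp only [hρ]; ring
    rw [e1, e2, Real.mul_rpow (by positivity) e0.le, Real.mul_rpow (by positivity) e0.le, hA, hq,
      ← Real.rpow_natCast ((1 / 2 : ℝ) ^ (s - t)), ← Real.rpow_mul (by norm_num),
      ← Real.rpow_natCast (1 / 2 : ℝ) k, ← Real.rpow_mul (by norm_num),
      ← Real.rpow_mul (by norm_num)]
    have e3 : (1 / 2 : ℝ) ^ ((s - t) * k) = (1 / 2) ^ (k * -t) * (1 / 2) ^ (k * s) := by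
      rw [← Real.rpow_add (by norm_num)]; ring_nf
    rw [e3]; ring
  have hsum : Summable fun k : ℕ => A * q ^ k :=
    (summable_geometric_of_lt_one hq0 hq1).mul_left A
  have hfin : ∑' k : ℕ, ENNReal.ofReal (A * q ^ k) ≠ ∞ := hsum.tsum_ofReal_ne_top
  refine ne_top_of_le_ne_top hfin ((packingMeasure_le_packingPremeasure s F).trans ?_)
  refine iInf₂_le_of_le δ hδ (iSup₂_le fun P hP => ?_)
  have hex : ∀ p : X × ℝ, ∃ k : ℕ, p ∈ P → ρ (k + 1) < p.2 ∧ p.2 ≤ ρ k := by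
    intro p
    by_cases hp : p ∈ P
    · obtain ⟨-, h0, h1⟩ := hP.1 p hp
      obtain ⟨n, hn1, hn2⟩ := exists_nat_pow_near_of_lt_one (div_pos h0 hδ)
        ((div_le_one hδ).2 h1) (by norm_num : (0 : ℝ) < 1 / 2) (by norm_num)
      refine ⟨n, fun _ => ⟨?_, ?_⟩⟩
      · rw [lt_div_iff₀ hδ] at hn1; simp only [hρ]; linarith
      · rw [div_le_iff₀ hδ] at hn2; simp only [hρ]; linarith
    · exact ⟨0, fun h => absurd h hp⟩
  choose κ hκ using hex
  rw [← Finset.sum_fiberwise_of_maps_to (t := P.image κ) (g := κ)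
    (fun p hp => Finset.mem_image_of_mem κ hp)]
  refine le_trans (Finset.sum_le_sum fun k _ => ?_) (ENNReal.sum_le_tsum (P.image κ))
  have hcard : ((P.filter fun p => κ p = k).card : ℝ≥0∞) ≤
      ENNReal.ofReal ((ρ (k + 2)) ^ (-t)) := by
    refine (hP.card_le_sep (hρ0 (k + 1)).le (Finset.filter_subset _ _) ?_).trans ?_
    · intro p hp
      obtain ⟨hp', rfl⟩ := Finset.mem_filter.1 hp
      exact (hκ p hp').1
    · have e : ρ (k + 1) = 2 * ρ (k + 2) := by simp only [hρ]; ring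
      rw [e]
      refine sep_two_mul_le_cov.trans (hcov _ (hρ0 _) ?_)
      exact mul_le_of_le_one_right hδ.le (pow_le_one₀ (by norm_num) (by norm_num))
  calc ∑ p ∈ P.filter (fun p => κ p = k), ENNReal.ofReal (2 * p.2) ^ s
      ≤ ∑ p ∈ P.filter (fun p => κ p = k), ENNReal.ofReal ((2 * ρ k) ^ s) := by
        refine Finset.sum_le_sum fun p hp => ?_
        obtain ⟨hp', rfl⟩ := Finset.mem_filter.1 hp
        rw [ENNReal.ofReal_rpow_of_nonneg (by linarith [(hP.1 p hp').2.1]) hs]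
        refine ENNReal.ofReal_le_ofReal (Real.rpow_le_rpow (by linarith [(hP.1 p hp').2.1]) ?_ hs)
        linarith [(hκ p hp').2]
    _ = ((P.filter fun p => κ p = k).card : ℝ≥0∞) * ENNReal.ofReal ((2 * ρ k) ^ s) := by
        rw [Finset.sum_const, nsmul_eq_mul]
    _ ≤ ENNReal.ofReal ((ρ (k + 2)) ^ (-t)) * ENNReal.ofReal ((2 * ρ k) ^ s) := by gcongr
    _ = ENNReal.ofReal (A * q ^ k) := by
        rw [← ENNReal.ofReal_mul (Real.rpow_nonneg (hρ0 _).le _), hC]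

lemma packingDim_le_upperBoxDim (hF : F.Nonempty) : (packingDim F : EReal) ≤ upperBoxDim F := by
  by_contra! hlt
  obtain ⟨t, ht1, ht2⟩ := EReal.lt_iff_exists_real_btwn.1 hlt
  have ht0 : 0 < t := by exact_mod_cast (upperBoxDim_nonneg hF).trans_lt ht1
  have : ((ENNReal.ofReal t : ℝ≥0∞) : EReal) < packingDim F := by
    simpa [EReal.coe_ennreal_ofReal, max_eq_left ht0.le] using ht2
  rw [EReal.coe_ennreal_lt_coe_ennreal_iff, packingDim] at this
  obtain ⟨s, hs⟩ := lt_iSup_iff.1 this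
  obtain ⟨hinf, hs⟩ := lt_iSup_iff.1 hs
  have hts : t < s := by
    rw [ENNReal.ofReal_lt_coe_iff ht0.le] at hs
    exact hs
  exact packingMeasure_ne_top_of_upperBoxDim_lt s.2 hts ht1 hinf

lemma exists_sep_le_of_packingPremeasure_ne_top {s : ℝ} {E : Set X}
    (h : packingPremeasure s E ≠ ∞) :
    ∃ δ₀ > 0, ∃ C : ℝ, ∀ δ : ℝ, 0 < δ → δ ≤ δ₀ →
      sep (2 * δ) E ≤ ENNReal.ofReal (C * δ ^ (-s)) := by
  obtain ⟨δ₀, hδ₀, hfin⟩ : ∃ δ₀ > 0, packingSup s δ₀ E ≠ ∞ := by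
    by_contra! hall
    exact h (by simpa [packingPremeasure] using hall)
  refine ⟨δ₀, hδ₀, (packingSup s δ₀ E).toReal * 2 ^ (-s), fun δ h0 hδ => ?_⟩
  refine sep_le (by positivity) fun T hT hs => ?_
  let φ : X ↪ X × ℝ := ⟨fun x => (x, δ), Prod.mk_left_injective δ⟩
  have hP : IsPacking E δ₀ (T.map φ) := by
    constructor
    · intro p hp
      obtain ⟨x, hx, rfl⟩ := Finset.mem_map.1 hp
      exact ⟨hT hx, h0, hδ⟩
    · intro p hp q hq hpq
      obtain ⟨x, hx, rfl⟩ := Finset.mem_map.1 (Finset.mem_coe.1 hp)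
      obtain ⟨y, hy, rfl⟩ := Finset.mem_map.1 (Finset.mem_coe.1 hq)
      refine Metric.closedBall_disjoint_closedBall ?_
      have := hs hx hy fun h => hpq (by rw [h])
      change δ + δ < dist x y
      linarith
  have h1 : ∑ p ∈ T.map φ, ENNReal.ofReal (2 * p.2) ^ s ≤ packingSup s δ₀ E :=
    le_iSup₂_of_le _ hP le_rfl
  rw [Finset.sum_map] at h1
  change ∑ _x ∈ T, ENNReal.ofReal (2 * δ) ^ s ≤ _ at h1
  rw [Finset.sum_const, nsmul_eq_mul] at h1
  rw [ENNReal.ofReal_rpow_of_pos (by positivity), ← ENNReal.ofReal_toReal hfin,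
    ← ENNReal.ofReal_natCast, ← ENNReal.ofReal_mul (by positivity),
    ENNReal.ofReal_le_ofReal_iff ENNReal.toReal_nonneg] at h1
  rw [← ENNReal.ofReal_natCast]
  refine ENNReal.ofReal_le_ofReal ?_
  have hp : 0 < (2 * δ) ^ s := by positivity
  rw [mul_assoc, ← Real.mul_rpow (by norm_num) h0.le, Real.rpow_neg (by positivity),
    ← div_eq_mul_inv, le_div_iff₀ hp]
  exact h1

end Packing

/-- If every relatively open piece of a compact set contains a copy of the set under a map that
contracts distances by at most a constant factor, then a finite packing measure bounds the upper
box dimension. By Baire, one member of a countable cover by sets of finite premeasure is dense in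
some relatively open piece, and box counting does not see the difference between a set and its
closure. -/
lemma upperBoxDim_le_of_packingMeasure_ne_top {X : Type*} [MetricSpace X] {Λ : Set X}
    (hc : IsCompact Λ) (hne : Λ.Nonempty)
    (hself : ∀ x ∈ Λ, ∀ ε > 0, ∃ g : X → X, MapsTo g Λ (Λ ∩ Metric.ball x ε) ∧
      ∃ c > 0, ∀ y z, c * dist y z ≤ dist (g y) (g z))
    {s : ℝ} (h : packingMeasure s Λ ≠ ∞) : upperBoxDim Λ ≤ s := by
  obtain ⟨E, hcover, hE⟩ : ∃ E : ℕ → Set X, Λ ⊆ ⋃ n, E n ∧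
      ∑' n, packingPremeasure s (E n) ≠ ∞ := by
    by_contra! hall
    exact h (by simpa [packingMeasure] using hall)
  have : CompactSpace Λ := isCompact_iff_compactSpace.1 hc
  have : Nonempty Λ := hne.to_subtype
  obtain ⟨n, x, hx⟩ := nonempty_interior_of_iUnion_of_closed
    (f := fun n => ((↑) : Λ → X) ⁻¹' closure (E n))
    (fun n => isClosed_closure.preimage continuous_subtype_val) (by
      rw [eq_univ_iff_forall]
      intro y
      obtain ⟨n, hn⟩ := mem_iUnion.1 (hcover y.2)
      exact mem_iUnion.2 ⟨n, subset_closure hn⟩)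
  obtain ⟨ε, hε, hball⟩ := Metric.isOpen_iff.1 isOpen_interior x hx
  have hsub : Λ ∩ Metric.ball (x : X) ε ⊆ closure (E n) := by
    rintro y ⟨hy, hyx⟩
    have hmem := hball (show (⟨y, hy⟩ : Λ) ∈ Metric.ball x ε from hyx)
    exact (interior_subset hmem : (⟨y, hy⟩ : Λ) ∈ ((↑) : Λ → X) ⁻¹' closure (E n))
  obtain ⟨g, hg, c, hc0, hgc⟩ := hself x x.2 ε hε
  obtain ⟨δ₀, hδ₀, C, hC⟩ := exists_sep_le_of_packingPremeasure_ne_top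
    (ENNReal.ne_top_of_tsum_ne_top hE n)
  refine upperBoxDim_le_of_cov_le (k := 4 * δ₀ / c) (C := C * δ₀ ^ (-s)) (by positivity)
    fun η hη => ?_
  have hη0 := hη.1
  calc cov (4 * δ₀ / c * η) Λ ≤ sep (4 * δ₀ / c * η) Λ := cov_le_sep
    _ ≤ sep (2 * (2 * (δ₀ * η))) (closure (E n)) := by
        refine sep_le_sep_of_map (by positivity) (by positivity) g (hg.mono_right hsub) ?_
        intro y _ z _ hyz
        refine lt_of_lt_of_le ?_ (hgc y z)
        have := mul_lt_mul_of_pos_left hyz hc0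
        refine lt_of_eq_of_lt ?_ this
        field_simp; norm_num
    _ ≤ cov (2 * (δ₀ * η)) (closure (E n)) := sep_two_mul_le_cov
    _ ≤ cov (2 * (δ₀ * η)) (E n) := cov_closure_le (by positivity)
    _ ≤ sep (2 * (δ₀ * η)) (E n) := cov_le_sep
    _ ≤ ENNReal.ofReal (C * (δ₀ * η) ^ (-s)) :=
        hC _ (by positivity) (mul_le_of_le_one_right hδ₀.le hη.2.le)
    _ = ENNReal.ofReal (C * δ₀ ^ (-s) * η ^ (-s)) := by
        rw [Real.mul_rpow hδ₀.le hη0.le, mul_assoc]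

lemma packingDim_eq_upperBoxDim {X : Type*} [MetricSpace X] {Λ : Set X}
    (hc : IsCompact Λ) (hne : Λ.Nonempty)
    (hself : ∀ x ∈ Λ, ∀ ε > 0, ∃ g : X → X, MapsTo g Λ (Λ ∩ Metric.ball x ε) ∧
      ∃ c > 0, ∀ y z, c * dist y z ≤ dist (g y) (g z)) :
    (packingDim Λ : EReal) = upperBoxDim Λ := by
  refine le_antisymm (packingDim_le_upperBoxDim hne) ?_
  by_contra! hlt
  obtain ⟨t, ht1, ht2⟩ := EReal.lt_iff_exists_real_btwn.1 hlt
  have ht0 : 0 < t := by exact_mod_cast (EReal.coe_ennreal_nonneg _).trans_lt ht1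
  lift t to ℝ≥0 using ht0.le
  refine ht2.not_ge (upperBoxDim_le_of_packingMeasure_ne_top hc hne hself fun hinf => ?_)
  refine ht1.not_ge ?_
  have : (t : ℝ≥0∞) ≤ packingDim Λ := le_iSup₂_of_le t hinf le_rfl
  have h2 := EReal.coe_ennreal_le_coe_ennreal_iff.2 this
  exact h2

end TGL

/-! ### Words and induction along the tree of cylinders -/

namespace TGL

section Words

variable {ι X : Type*}

/-- The composition of maps of an iterated function system along a word. The head of the list is
the letter applied first, so that consing a letter passes to a smaller cylinder. -/
def wordMap (f : ι → X → X) : List ι → X → X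
  | [] => id
  | i :: w => wordMap f w ∘ f i

/-- The product of the weights of the letters of a word. -/
def wt (c : ι → ℝ) (w : List ι) : ℝ := (w.map c).prod

@[simp] lemma wt_nil (c : ι → ℝ) : wt c [] = 1 := rfl

@[simp] lemma wt_cons (c : ι → ℝ) (i : ι) (w : List ι) : wt c (i :: w) = c i * wt c w := by
  simp [wt]

lemma wt_pos {c : ι → ℝ} (hc : ∀ i, 0 < c i) (w : List ι) : 0 < wt c w := by
  induction w with
  | nil => simp
  | cons i w ih => rw [wt_cons]; exact mul_pos (hc i) ih

lemma wt_rpow {c : ι → ℝ} (hc : ∀ i, 0 < c i) (x : ℝ) (w : List ι) :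
    wt (fun i => c i ^ x) w = wt c w ^ x := by
  induction w with
  | nil => simp
  | cons i w ih => rw [wt_cons, wt_cons, ih, Real.mul_rpow (hc i).le (wt_pos hc w).le]

lemma wt_mul (c d : ι → ℝ) (w : List ι) : wt (fun i => c i * d i) w = wt c w * wt d w := by
  induction w with
  | nil => simp
  | cons i w ih => rw [wt_cons, wt_cons, wt_cons, ih]; ring

lemma wt_le_one {c : ι → ℝ} (hc : ∀ i, 0 < c i) (hc1 : ∀ i, c i < 1) (w : List ι) :
    wt c w ≤ 1 := by
  induction w with
  | nil => simp
  | cons i w ih => rw [wt_cons]; exact mul_le_one₀ (hc1 i).le (wt_pos hc w).le ih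

lemma wt_le_wt {c d : ι → ℝ} (hc : ∀ i, 0 < c i) (h : ∀ i, c i ≤ d i) (w : List ι) :
    wt c w ≤ wt d w := by
  induction w with
  | nil => simp
  | cons i w ih =>
    rw [wt_cons, wt_cons]
    exact mul_le_mul (h i) ih (wt_pos hc w).le ((hc i).le.trans (h i))

/-- Induction along the tree of words, stopped at scale `δ`: a property that passes from the
children of a word to the word holds for the empty word as soon as it holds for the words whose
weight lies in `(m δ, δ]`. -/
lemma tree_induction [Finite ι] {c : ι → ℝ} {m δ : ℝ} (hm0 : 0 < m) (hm1 : m < 1)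
    (hm : ∀ i, m ≤ c i) (hc1 : ∀ i, c i < 1) (hδ0 : 0 < δ) (hδ1 : δ ≤ 1) {P : List ι → Prop}
    (leaf : ∀ w, m * δ < wt c w → wt c w ≤ δ → P w)
    (step : ∀ w, δ < wt c w → (∀ i, P (i :: w)) → P w) : P [] := by
  have hc0 : ∀ i, 0 < c i := fun i => hm0.trans_le (hm i)
  obtain ⟨q, hq0, hq1, hq⟩ : ∃ q : ℝ, 0 ≤ q ∧ q < 1 ∧ ∀ i, c i ≤ q := by
    rcases isEmpty_or_nonempty ι with h | h
    · exact ⟨0, le_rfl, one_pos, fun i => (h.false i).elim⟩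
    · obtain ⟨j, hj⟩ := Finite.exists_max c
      exact ⟨c j, (hc0 j).le, hc1 j, hj⟩
  have key : ∀ n : ℕ, ∀ w, q ^ n * wt c w ≤ δ → m * δ < wt c w → P w := by
    intro n
    induction n with
    | zero => intro w h1 h2; exact leaf w h2 (by simpa using h1)
    | succ n ih =>
      intro w h1 h2
      rcases le_or_gt (wt c w) δ with h | h
      · exact leaf w h2 h
      · refine step w h fun i => ih _ ?_ ?_
        · rw [wt_cons]
          refine le_trans ?_ h1
          have := mul_le_mul_of_nonneg_right (hq i) (wt_pos hc0 w).le
          calc q ^ n * (c i * wt c w) ≤ q ^ n * (q * wt c w) := by gcongr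
            _ = q ^ (n + 1) * wt c w := by ring
        · rw [wt_cons]
          calc m * δ < m * wt c w := by gcongr
            _ ≤ c i * wt c w := mul_le_mul_of_nonneg_right (hm i) (wt_pos hc0 w).le
  obtain ⟨n, hn⟩ := exists_pow_lt_of_lt_one hδ0 hq1
  refine key n [] (by simpa using hn.le) ?_
  rw [wt_nil]
  exact (mul_le_of_le_one_right hm0.le hδ1).trans_lt hm1

lemma wordMap_injective {f : ι → X → X} (hf : ∀ i, Function.Injective (f i)) (w : List ι) :
    Function.Injective (wordMap f w) := by
  induction w with
  | nil => exact Function.injective_id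
  | cons i w ih => exact ih.comp (hf i)

lemma mapsTo_wordMap {f : ι → X → X} {s : Set X} (h : ∀ i, MapsTo (f i) s s) (w : List ι) :
    MapsTo (wordMap f w) s s := by
  induction w with
  | nil => exact mapsTo_id s
  | cons i w ih => exact ih.comp (h i)

variable [TopologicalSpace X] {f : ι → X → X} {Λ : Set X}

lemma IsAttractor.image_wordMap (h : IsAttractor f Λ) (w : List ι) :
    wordMap f w '' Λ = ⋃ i, wordMap f (i :: w) '' Λ := by
  conv_lhs => rw [h.2.2]
  rw [image_iUnion]
  simp only [wordMap, image_comp]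

lemma IsAttractor.mapsTo (h : IsAttractor f Λ) (i : ι) : MapsTo (f i) Λ Λ := by
  intro x hx
  rw [h.2.2]
  exact mem_iUnion.2 ⟨i, mem_image_of_mem _ hx⟩

/-- Every point of the attractor lies in a cylinder whose weight is comparable to `δ`. -/
lemma IsAttractor.exists_word [Finite ι] (h : IsAttractor f Λ) {c : ι → ℝ} {m δ : ℝ} (hm0 : 0 < m)
    (hm1 : m < 1) (hm : ∀ i, m ≤ c i) (hc1 : ∀ i, c i < 1) (hδ0 : 0 < δ) (hδ1 : δ ≤ 1)
    {x : X} (hx : x ∈ Λ) :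
    ∃ w, x ∈ wordMap f w '' Λ ∧ m * δ < wt c w ∧ wt c w ≤ δ := by
  refine tree_induction (P := fun w => x ∈ wordMap f w '' Λ →
    ∃ w, x ∈ wordMap f w '' Λ ∧ m * δ < wt c w ∧ wt c w ≤ δ) hm0 hm1 hm hc1 hδ0 hδ1 ?_ ?_
    (by simpa [wordMap] using hx)
  · exact fun w h1 h2 hxw => ⟨w, hxw, h1, h2⟩
  · intro w _ ih hxw
    rw [h.image_wordMap] at hxw
    obtain ⟨i, hi⟩ := mem_iUnion.1 hxw
    exact ih i hi

end Words

lemma exists_lower_weight {ι : Type*} [Finite ι] [Nonempty ι] {c : ι → ℝ} (hc0 : ∀ i, 0 < c i)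
    (hc1 : ∀ i, c i < 1) : ∃ m : ℝ, 0 < m ∧ m < 1 ∧ ∀ i, m ≤ c i := by
  obtain ⟨j, hj⟩ := Finite.exists_min c
  exact ⟨c j, hc0 j, hc1 j, hj⟩

lemma sum_ofReal_mul_wt_cons {ι : Type*} [Fintype ι] {p : ι → ℝ} (hp : ∀ i, 0 < p i) {B : ℝ}
    (hB : 0 ≤ B) (w : List ι) :
    ∑ i, ENNReal.ofReal (B * wt p (i :: w)) = ENNReal.ofReal (B * ((∑ i, p i) * wt p w)) := by
  rw [← ENNReal.ofReal_sum_of_nonneg fun i _ => mul_nonneg hB (wt_pos hp _).le]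
  congr 1
  rw [Finset.sum_mul, Finset.mul_sum]
  simp

/-! ### Exponents solving a pressure equation, and Fekete's lemma for power laws -/

/-- The equation `∑ αᵢ βᵢ ^ (x - m) = 1` has exactly one solution, the left-hand side being a
strictly decreasing continuous function of `x` with range `(0, ∞)`. -/
lemma exists_unique_exponent {ι : Type*} [Fintype ι] [Nonempty ι] {α β : ι → ℝ}
    (hα : ∀ i, 0 < α i) (hβ0 : ∀ i, 0 < β i) (hβ1 : ∀ i, β i < 1) (m : ℝ) :
    ∃ s : ℝ, ∀ x : ℝ, ∑ i, α i * β i ^ (x - m) = 1 ↔ x = s := by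
  set G : ℝ → ℝ := fun x => ∑ i, α i * β i ^ (x - m) with hG
  have hanti : StrictAnti G := by
    intro x y hxy
    refine Finset.sum_lt_sum_of_nonempty Finset.univ_nonempty fun i _ => ?_
    exact mul_lt_mul_of_pos_left
      (Real.rpow_lt_rpow_of_exponent_gt (hβ0 i) (hβ1 i) (by linarith)) (hα i)
  have hcont : Continuous G := by
    refine continuous_finsetSum _ fun i _ => continuous_const.mul ?_
    exact continuous_const.rpow (by fun_prop) fun x => Or.inl (hβ0 i).ne'
  have htop : Tendsto G atTop (𝓝 0) := by
    have : Tendsto G atTop (𝓝 (∑ i, α i * 0)) := by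
      refine tendsto_finsetSum _ fun i _ => Tendsto.const_mul _ ?_
      exact (tendsto_rpow_atTop_of_base_lt_one _ (by linarith [hβ0 i]) (hβ1 i)).comp
        (tendsto_atTop_add_const_right _ (-m) tendsto_id)
    simpa using this
  have hbot : Tendsto G atBot atTop := by
    obtain ⟨j⟩ := ‹Nonempty ι›
    have h1 : Tendsto (fun x => α j * β j ^ (x - m)) atBot atTop := by
      refine Tendsto.const_mul_atTop (hα j) ?_
      exact (tendsto_rpow_atBot_of_base_lt_one _ (hβ0 j) (hβ1 j)).comp
        (tendsto_atBot_add_const_right _ (-m) tendsto_id)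
    refine tendsto_atTop_mono (fun x => ?_) h1
    exact Finset.single_le_sum (f := fun i => α i * β i ^ (x - m))
      (fun i _ => mul_nonneg (hα i).le (Real.rpow_nonneg (hβ0 i).le _)) (Finset.mem_univ j)
  obtain ⟨x₁, h₁⟩ := (htop.eventually (Iic_mem_nhds one_pos)).exists
  obtain ⟨x₂, h₂⟩ := (hbot.eventually_ge_atTop 1).exists
  obtain ⟨s, hs⟩ := mem_range_of_exists_le_of_exists_ge hcont ⟨x₁, h₁⟩ ⟨x₂, h₂⟩
  exact ⟨s, fun x => ⟨fun hx => hanti.injective (hx.trans hs.symm), fun hx => hx ▸ hs⟩⟩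

/-- A multiplicative form of Fekete's lemma: a supermultiplicative function of the scale, up to a
constant `c`, with at most polynomial growth follows a power law `δ ^ (-s)`, without loss from
above and up to an arbitrarily small loss in the exponent from below. -/
lemma exists_powerLaw_of_supermultiplicative {g : ℝ → ℝ} {c A x : ℝ} (hc0 : 0 < c) (hc1 : c < 1)
    (h1 : ∀ δ ∈ Ioc (0 : ℝ) 1, 1 ≤ g δ)
    (hmul : ∀ δ ∈ Ioc (0 : ℝ) 1, ∀ η ∈ Ioc (0 : ℝ) 1, g δ * g η ≤ g (c * δ * η))
    (hbd : ∀ δ ∈ Ioc (0 : ℝ) 1, g δ ≤ A * δ ^ (-x)) :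
    ∃ s : ℝ, (∃ C > 0, ∀ δ ∈ Ioc (0 : ℝ) 1, g δ ≤ C * δ ^ (-s)) ∧
      ∀ ε > 0, ∃ k > 0, ∀ δ ∈ Ioc (0 : ℝ) 1, k * δ ^ (-(s - ε)) ≤ g δ := by
  set τ : ℝ := -Real.log c with hτ
  have hτ0 : 0 < τ := by have := Real.log_neg hc0 hc1; linarith
  have hexp : ∀ t : ℝ, 0 ≤ t → Real.exp (-t) ∈ Ioc (0 : ℝ) 1 := fun t ht =>
    ⟨Real.exp_pos _, Real.exp_le_one_iff.2 (by linarith)⟩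
  set φ : ℝ → ℝ := fun t => Real.log (g (Real.exp (-t))) with hφ
  have hgφ : ∀ t, 0 ≤ t → g (Real.exp (-t)) = Real.exp (φ t) := fun t ht =>
    (Real.exp_log (one_pos.trans_le (h1 _ (hexp t ht)))).symm
  have hφ0 : ∀ t, 0 ≤ t → 0 ≤ φ t := fun t ht => Real.log_nonneg (h1 _ (hexp t ht))
  have hadd : ∀ t t', 0 ≤ t → 0 ≤ t' → φ t + φ t' ≤ φ (t + τ + t') := by
    intro t t' ht ht'
    have := hmul _ (hexp t ht) _ (hexp t' ht')
    have e : c * Real.exp (-t) * Real.exp (-t') = Real.exp (-(t + τ + t')) := by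
      rw [← Real.exp_log hc0, ← Real.exp_add, ← Real.exp_add]
      congr 1; rw [hτ]; ring
    rw [e, hgφ t ht, hgφ t' ht', hgφ _ (by positivity), ← Real.exp_add, Real.exp_le_exp] at this
    exact this
  have hA : 0 < A := by
    have h := hbd 1 ⟨one_pos, le_rfl⟩
    have h' := h1 1 ⟨one_pos, le_rfl⟩
    simp at h; linarith
  have hφle : ∀ t, 0 ≤ t → φ t ≤ Real.log A + x * t := by
    intro t ht
    have := hbd _ (hexp t ht)
    rw [hgφ t ht, ← Real.exp_mul] at this
    have h2 := Real.log_le_log (Real.exp_pos _) this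
    rw [Real.log_exp, Real.log_mul hA.ne' (Real.exp_pos _).ne', Real.log_exp] at h2
    linarith
  set S : Set ℝ := (fun t => φ t / (t + τ)) '' Ici 0 with hS
  have hbdd : BddAbove S := by
    refine ⟨|x| + |Real.log A| / τ, ?_⟩
    rintro _ ⟨t, ht, rfl⟩
    have ht : 0 ≤ t := ht
    have h3 : 0 < t + τ := by positivity
    rw [div_le_iff₀ h3]
    have h4 : |Real.log A| ≤ |Real.log A| / τ * (t + τ) := by
      rw [div_mul_eq_mul_div, le_div_iff₀ hτ0]
      exact mul_le_mul_of_nonneg_left (by linarith) (abs_nonneg _)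
    have h5 : x * t ≤ |x| * (t + τ) :=
      (mul_le_mul_of_nonneg_right (le_abs_self x) ht).trans
        (mul_le_mul_of_nonneg_left (by linarith) (abs_nonneg _))
    linarith [hφle t ht, le_abs_self (Real.log A)]
  have hne : S.Nonempty := ⟨_, 0, self_mem_Ici, rfl⟩
  set s : ℝ := sSup S with hs
  have hup : ∀ t, 0 ≤ t → φ t ≤ s * (t + τ) := by
    intro t ht
    rw [← div_le_iff₀ (by positivity)]
    exact le_csSup hbdd ⟨t, ht, rfl⟩
  have hlog : ∀ δ ∈ Ioc (0 : ℝ) 1, 0 ≤ -Real.log δ ∧ g δ = Real.exp (φ (-Real.log δ)) := by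
    intro δ hδ
    have h0 : 0 ≤ -Real.log δ := by
      have := Real.log_nonpos hδ.1.le hδ.2; linarith
    refine ⟨h0, ?_⟩
    rw [← hgφ _ h0, neg_neg, Real.exp_log hδ.1]
  refine ⟨s, ⟨Real.exp (s * τ), Real.exp_pos _, fun δ hδ => ?_⟩, fun ε hε => ?_⟩
  · obtain ⟨h0, hg⟩ := hlog δ hδ
    rw [hg, Real.rpow_def_of_pos hδ.1, ← Real.exp_add, Real.exp_le_exp]
    linarith [hup _ h0]
  · obtain ⟨_, ⟨t₀, ht₀, rfl⟩, hlt⟩ := exists_lt_of_lt_csSup hne (sub_lt_self s hε)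
    have ht₀ : 0 ≤ t₀ := ht₀
    have hv : 0 < t₀ + τ := by positivity
    have hiter : ∀ (n : ℕ) (t : ℝ), 0 ≤ t → n * φ t₀ ≤ φ (n * (t₀ + τ) + t) := by
      intro n t ht
      induction n with
      | zero => simpa using hφ0 t ht
      | succ n ih =>
        have := hadd t₀ (n * (t₀ + τ) + t) ht₀ (by positivity)
        push_cast
        have e : t₀ + τ + (n * (t₀ + τ) + t) = (n + 1) * (t₀ + τ) + t := by ring
        rw [e] at this
        linarith
    refine ⟨Real.exp (-φ t₀), Real.exp_pos _, fun δ hδ => ?_⟩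
    obtain ⟨h0, hg⟩ := hlog δ hδ
    rw [hg, Real.rpow_def_of_pos hδ.1, ← Real.exp_add, Real.exp_le_exp]
    set t := -Real.log δ with ht
    set n := ⌊t / (t₀ + τ)⌋₊ with hn
    have hn1 : (n : ℝ) * (t₀ + τ) ≤ t := by
      rw [← le_div_iff₀ hv]; exact Nat.floor_le (by positivity)
    have hn2 : t / (t₀ + τ) - 1 ≤ n := (Nat.sub_one_lt_floor _).le
    have h4 := hiter n (t - n * (t₀ + τ)) (by linarith)
    have e : (n : ℝ) * (t₀ + τ) + (t - n * (t₀ + τ)) = t := by ring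
    rw [e] at h4
    have h5 : (t / (t₀ + τ) - 1) * φ t₀ ≤ n * φ t₀ :=
      mul_le_mul_of_nonneg_right hn2 (hφ0 t₀ ht₀)
    have h6 : (s - ε) * t ≤ φ t₀ / (t₀ + τ) * t := mul_le_mul_of_nonneg_right hlt.le h0
    have e2 : φ t₀ / (t₀ + τ) * t = t / (t₀ + τ) * φ t₀ := by ring
    have e3 : Real.log δ * -(s - ε) = (s - ε) * t := by rw [ht]; ring
    rw [e3]
    linarith

end TGL

/-! ### Self-similar sets on the line -/

namespace TGL

lemma sep_le_one {X : Type*} [PseudoMetricSpace X] {F : Set X} {δ : ℝ} (hδ : 0 ≤ δ)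
    (h : ∀ x ∈ F, ∀ y ∈ F, dist x y ≤ δ) : sep δ F ≤ 1 := by
  refine sep_le hδ fun T hT hs => ?_
  have : T.card ≤ 1 := Finset.card_le_one.2 fun x hx y hy => by
    by_contra hne
    exact (hs hx hy hne).not_ge (h x (hT hx) y (hT hy))
  exact_mod_cast this

lemma le_lowerBoxDim_of_forall_pos {X : Type*} [PseudoMetricSpace X] {F : Set X} {s : ℝ}
    (h : ∀ ε > 0, ((s - ε : ℝ) : EReal) ≤ lowerBoxDim F) : (s : EReal) ≤ lowerBoxDim F := by
  refine EReal.ge_of_forall_gt_iff_ge.1 fun z hz => ?_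
  have hz' : z < s := by exact_mod_cast hz
  have := h (s - z) (sub_pos.2 hz')
  rwa [sub_sub_cancel] at this

section Line

variable {ι : Type*} {r u : ι → ℝ} {K : Set ℝ}

/-- The similarity `x ↦ rᵢ x + uᵢ` of the line. -/
def lineMap (r u : ι → ℝ) (i : ι) (x : ℝ) : ℝ := r i * x + u i

lemma wordMap_lineMap_sub (r u : ι → ℝ) (w : List ι) (x y : ℝ) :
    wordMap (lineMap r u) w x - wordMap (lineMap r u) w y = wt r w * (x - y) := by
  induction w generalizing x y with
  | nil => simp [wordMap]
  | cons i w ih =>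
    simp only [wordMap, Function.comp, wt_cons, ih, lineMap]; ring

lemma dist_wordMap_lineMap (hr0 : ∀ i, 0 < r i) (w : List ι) (x y : ℝ) :
    dist (wordMap (lineMap r u) w x) (wordMap (lineMap r u) w y) = wt r w * dist x y := by
  rw [Real.dist_eq, Real.dist_eq, wordMap_lineMap_sub, abs_mul, abs_of_pos (wt_pos hr0 w)]

/-- The attractor of a self-similar system on the line lies in every nonempty closed bounded set
that the system maps into itself. -/
lemma IsAttractor.subset_of_mapsTo [Finite ι] [Nonempty ι] (hK : IsAttractor (lineMap r u) K)
    (hr0 : ∀ i, 0 < r i) (hr1 : ∀ i, r i < 1) {B : Set ℝ} (hB : IsCompact B) (hBne : B.Nonempty)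
    (hmap : ∀ i, MapsTo (lineMap r u i) B B) : K ⊆ B := by
  obtain ⟨m, hm0, hm1, hm⟩ := exists_lower_weight hr0 hr1
  obtain ⟨b, hb⟩ := hBne
  obtain ⟨R, hR⟩ := hK.2.1.isBounded.subset_closedBall b
  intro x hx
  rw [← hB.isClosed.closure_eq, Metric.mem_closure_iff]
  intro ε hε
  have hδ0 : 0 < min 1 (ε / (|R| + 1)) := lt_min one_pos (by positivity)
  obtain ⟨w, ⟨z, hz, rfl⟩, -, hw⟩ := hK.exists_word hm0 hm1 hm hr1 hδ0 (min_le_left _ _) hx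
  refine ⟨_, mapsTo_wordMap hmap w hb, ?_⟩
  rw [dist_wordMap_lineMap hr0]
  have h1 : dist z b ≤ |R| := (Metric.mem_closedBall.1 (hR hz)).trans (le_abs_self R)
  calc wt r w * dist z b ≤ ε / (|R| + 1) * |R| :=
        mul_le_mul (hw.trans (min_le_right _ _)) h1 dist_nonneg (by positivity)
    _ < ε := by
        rw [div_mul_eq_mul_div, div_lt_iff₀ (by positivity)]
        nlinarith [abs_nonneg R]

variable [Fintype ι]

lemma dist_le_one_of_subset_Icc {K : Set ℝ} (hK : K ⊆ Icc 0 1) {x y : ℝ} (hx : x ∈ K)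
    (hy : y ∈ K) : dist x y ≤ 1 := by
  simpa using Real.dist_le_of_mem_Icc (hK hx) (hK hy)

/-- A self-similar set on the line whose ratios satisfy `∑ rᵢ ^ x ≤ 1` has at most a constant times
`δ ^ (-x)` points that are `δ`-separated, overlaps or not. -/
lemma IsAttractor.sep_le_of_sum_rpow_le_one [Nonempty ι] (hK : IsAttractor (lineMap r u) K)
    (hr0 : ∀ i, 0 < r i) (hr1 : ∀ i, r i < 1) (hK1 : K ⊆ Icc 0 1) {x : ℝ} (hx : 0 ≤ x)
    (hsum : ∑ i, r i ^ x ≤ 1) :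
    ∃ C : ℝ, ∀ δ ∈ Ioc (0 : ℝ) 1, sep δ K ≤ ENNReal.ofReal (C * δ ^ (-x)) := by
  obtain ⟨m, hm0, hm1, hm⟩ := exists_lower_weight hr0 hr1
  refine ⟨m ^ (-x), fun δ hδ => ?_⟩
  have hδ0 := hδ.1
  set p : ι → ℝ := fun i => r i ^ x with hp
  have hp0 : ∀ i, 0 < p i := fun i => Real.rpow_pos_of_pos (hr0 i) x
  have key : sep δ (wordMap (lineMap r u) [] '' K) ≤
      ENNReal.ofReal (m ^ (-x) * δ ^ (-x) * wt p []) := by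
    refine tree_induction (P := fun w => sep δ (wordMap (lineMap r u) w '' K) ≤
      ENNReal.ofReal (m ^ (-x) * δ ^ (-x) * wt p w)) hm0 hm1 hm hr1 hδ.1 hδ.2 ?_ ?_
    · intro w h1 h2
      refine (sep_le_one hδ0.le ?_).trans ?_
      · rintro _ ⟨y, hy, rfl⟩ _ ⟨z, hz, rfl⟩
        rw [dist_wordMap_lineMap hr0]
        exact (mul_le_of_le_one_right (wt_pos hr0 w).le
          (dist_le_one_of_subset_Icc hK1 hy hz)).trans h2
      · rw [← ENNReal.ofReal_one]
        refine ENNReal.ofReal_le_ofReal ?_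
        rw [wt_rpow hr0, ← Real.mul_rpow hm0.le hδ0.le, Real.rpow_neg (by positivity),
          ← div_eq_inv_mul, one_le_div (by positivity)]
        exact Real.rpow_le_rpow (by positivity) h1.le hx
    · intro w _ ih
      have hB : 0 ≤ m ^ (-x) * δ ^ (-x) := by positivity
      rw [hK.image_wordMap]
      refine (sep_iUnion_le hδ0.le _).trans ((Finset.sum_le_sum fun i _ => ih i).trans ?_)
      rw [sum_ofReal_mul_wt_cons hp0 hB]
      refine ENNReal.ofReal_le_ofReal (mul_le_mul_of_nonneg_left ?_ hB)
      exact mul_le_of_le_one_left (wt_pos hp0 w).le hsum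
  simpa [wordMap] using key

/-- Inside a cylinder of size comparable to `δ` around each of the points of a `δ`-separated set
one finds a copy of an `η`-separated set, so the number of separated points is supermultiplicative
in the scale up to a constant. -/
lemma IsAttractor.sep_mul_sep_le (hK : IsAttractor (lineMap r u) K)
    (hr0 : ∀ i, 0 < r i) (hr1 : ∀ i, r i < 1) (hK1 : K ⊆ Icc 0 1) {m : ℝ} (hm0 : 0 < m)
    (hm1 : m < 1) (hm : ∀ i, m ≤ r i) {δ η : ℝ} (hδ : δ ∈ Ioc (0 : ℝ) 1) (hη : η ∈ Ioc (0 : ℝ) 1)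
    (hδfin : sep δ K ≠ ∞) (hηfin : sep η K ≠ ∞) :
    sep δ K * sep η K ≤ sep (m / 4 * δ * η) K := by
  classical
  have hδ0 := hδ.1
  have hη0 := hη.1
  obtain ⟨T, hT, hTs, hTc⟩ := exists_finset_card_eq_sep hδ0.le hδfin
  obtain ⟨S, hS, hSs, hSc⟩ := exists_finset_card_eq_sep hη0.le hηfin
  have hex : ∀ x : ℝ, ∃ w, x ∈ K → x ∈ wordMap (lineMap r u) w '' K ∧
      m * (δ / 4) < wt r w ∧ wt r w ≤ δ / 4 := by
    intro x
    by_cases hx : x ∈ K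
    · obtain ⟨w, hw⟩ := hK.exists_word hm0 hm1 hm hr1 (by positivity : 0 < δ / 4)
        (by linarith [hδ.2]) hx
      exact ⟨w, fun _ => hw⟩
    · exact ⟨[], fun h => absurd h hx⟩
  choose W hW using hex
  set g : ℝ × ℝ → ℝ := fun p => wordMap (lineMap r u) (W p.1) p.2 with hg
  have hnear : ∀ x ∈ K, ∀ y ∈ K, dist (g (x, y)) x ≤ δ / 4 := by
    intro x hx y hy
    obtain ⟨⟨z, hz, hzx⟩, -, h2⟩ := hW x hx
    have : dist (g (x, y)) x = wt r (W x) * dist y z := by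
      rw [← dist_wordMap_lineMap (u := u) hr0, hzx]
    rw [this]
    exact (mul_le_of_le_one_right (wt_pos hr0 _).le
      (dist_le_one_of_subset_Icc hK1 hy hz)).trans h2
  have hsepar : ∀ p ∈ T ×ˢ S, ∀ q ∈ T ×ˢ S, p ≠ q → m / 4 * δ * η < dist (g p) (g q) := by
    rintro ⟨x, y⟩ hp ⟨x', y'⟩ hq hne
    rw [Finset.mem_product] at hp hq
    have hx := hT hp.1
    have hx' := hT hq.1
    have hy := hS hp.2
    have hy' := hS hq.2
    by_cases hxx : x = x'
    · subst hxx
      have hyy : y ≠ y' := fun h => hne (by rw [h])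
      have h1 := hSs hp.2 hq.2 hyy
      have h2 := (hW x hx).2.1
      simp only [hg]
      rw [dist_wordMap_lineMap hr0]
      calc m / 4 * δ * η = m * (δ / 4) * η := by ring
        _ < wt r (W x) * dist y y' := mul_lt_mul'' h2 h1 (by positivity) hη0.le
    · have h1 := hTs hp.1 hq.1 hxx
      have h2 := hnear x hx y hy
      have h3 := hnear x' hx' y' hy'
      have h4 : dist x x' ≤ dist (g (x, y)) x + dist (g (x, y)) (g (x', y'))
          + dist (g (x', y')) x' := by
        rw [dist_comm (g (x, y)) x]
        exact dist_triangle4 _ _ _ _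
      have h5 : m / 4 * δ * η ≤ δ / 4 := by
        have : m * η ≤ 1 := mul_le_one₀ hm1.le hη0.le hη.2
        nlinarith
      linarith
  have hinj : Set.InjOn g (T ×ˢ S : Finset (ℝ × ℝ)) := by
    intro p hp q hq hpq
    by_contra hne
    have := hsepar p hp q hq hne
    rw [hpq, dist_self] at this
    exact absurd this (by positivity : (0 : ℝ) ≤ m / 4 * δ * η).not_gt
  rw [← hTc, ← hSc, ← Nat.cast_mul, ← Finset.card_product, ← Finset.card_image_of_injOn hinj]
  refine card_le_sep (by positivity) _ ?_ ?_
  · intro z hz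
    obtain ⟨p, hp, rfl⟩ := Finset.mem_image.1 (Finset.mem_coe.1 hz)
    exact mapsTo_wordMap hK.mapsTo _ (hS (Finset.mem_product.1 hp).2)
  · intro z hz z' hz' hzz
    obtain ⟨p, hp, rfl⟩ := Finset.mem_image.1 (Finset.mem_coe.1 hz)
    obtain ⟨q, hq, rfl⟩ := Finset.mem_image.1 (Finset.mem_coe.1 hz')
    exact hsepar p hp q hq fun h => hzz (by rw [h])

/-- The numbers of separated points of a self-similar set on the line follow a power law. The
condition `∑ rᵢ ≤ 1` only serves to bound them a priori. -/
lemma IsAttractor.exists_powerLaw [Nonempty ι] (hK : IsAttractor (lineMap r u) K)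
    (hr0 : ∀ i, 0 < r i) (hr1 : ∀ i, r i < 1) (hK1 : K ⊆ Icc 0 1) (hsum : ∑ i, r i ≤ 1) :
    ∃ s : ℝ, (∃ C > 0, ∀ δ ∈ Ioc (0 : ℝ) 1, sep δ K ≤ ENNReal.ofReal (C * δ ^ (-s))) ∧
      ∀ ε > 0, ∃ k > 0, ∀ δ ∈ Ioc (0 : ℝ) 1,
        ENNReal.ofReal (k * δ ^ (-(s - ε))) ≤ sep δ K := by
  obtain ⟨m, hm0, hm1, hm⟩ := exists_lower_weight hr0 hr1
  obtain ⟨A, hA⟩ := hK.sep_le_of_sum_rpow_le_one hr0 hr1 hK1 zero_le_one (by simpa using hsum)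
  have hfin : ∀ δ ∈ Ioc (0 : ℝ) 1, sep δ K ≠ ∞ := fun δ hδ =>
    ne_top_of_le_ne_top ENNReal.ofReal_ne_top (hA δ hδ)
  have hone : ∀ δ, 1 ≤ sep δ K := fun δ => (one_le_cov hK.1).trans cov_le_sep
  have hone' : ∀ δ ∈ Ioc (0 : ℝ) 1, 1 ≤ (sep δ K).toReal := fun δ hδ => by
    simpa using ENNReal.toReal_mono (hfin δ hδ) (hone δ)
  obtain ⟨s, ⟨C, hC0, hC⟩, hlow⟩ := exists_powerLaw_of_supermultiplicative
    (g := fun δ => (sep δ K).toReal) (c := m / 4) (A := A) (x := 1) (by positivity) (by linarith)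
    hone' (by
      intro δ hδ η hη
      have hδ0 := hδ.1
      have hη0 := hη.1
      rw [← ENNReal.toReal_mul]
      refine ENNReal.toReal_mono (hfin _ ⟨by positivity, ?_⟩)
        (hK.sep_mul_sep_le hr0 hr1 hK1 hm0 hm1 hm hδ hη (hfin δ hδ) (hfin η hη))
      exact mul_le_one₀ (mul_le_one₀ (by linarith) hδ0.le hδ.2) hη0.le hη.2)
    (by
      intro δ hδ
      have h2 := hA δ hδ
      refine (ENNReal.le_ofReal_iff_toReal_le (hfin δ hδ) ?_).1 h2
      by_contra! hneg
      rw [ENNReal.ofReal_of_nonpos hneg.le] at h2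
      exact absurd ((hone δ).trans h2) (by simp))
  refine ⟨s, ⟨C, hC0, fun δ hδ => ?_⟩, fun ε hε => ?_⟩
  · exact ENNReal.le_ofReal_iff_toReal_le (hfin δ hδ)
      (mul_nonneg hC0.le (Real.rpow_nonneg hδ.1.le _)) |>.2 (hC δ hδ)
  · obtain ⟨k, hk0, hk⟩ := hlow ε hε
    exact ⟨k, hk0, fun δ hδ => ENNReal.ofReal_le_of_le_toReal (hk δ hδ)⟩

end Line

lemma hasBoxDim_of_powerLaw {X : Type*} [PseudoMetricSpace X] {F : Set X} {s C : ℝ}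
    (hup : ∀ δ ∈ Ioc (0 : ℝ) 1, sep δ F ≤ ENNReal.ofReal (C * δ ^ (-s)))
    (hlow : ∀ ε > 0, ∃ k > 0, ∀ δ ∈ Ioc (0 : ℝ) 1,
      ENNReal.ofReal (k * δ ^ (-(s - ε))) ≤ sep δ F) : HasBoxDim F s := by
  have h1 : upperBoxDim F ≤ s := upperBoxDim_le_of_cov_le (k := 1) (C := C) one_pos fun δ hδ => by
    rw [one_mul]; exact cov_le_sep.trans (hup δ ⟨hδ.1, hδ.2.le⟩)
  have h2 : (s : EReal) ≤ lowerBoxDim F := le_lowerBoxDim_of_forall_pos fun ε hε => by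
    obtain ⟨k, hk0, hk⟩ := hlow ε hε
    refine le_lowerBoxDim_of_le_cov (k := 1 / 2) (by norm_num) hk0 fun δ hδ => ?_
    refine (hk δ ⟨hδ.1, hδ.2.le⟩).trans ?_
    have e : δ = 2 * (1 / 2 * δ) := by ring
    conv_lhs => rw [e]
    exact sep_two_mul_le_cov
  have h3 := lowerBoxDim_le_upperBoxDim F
  exact ⟨le_antisymm (h3.trans h1) h2, le_antisymm h1 (h2.trans h3)⟩

end TGL

/-! ### Geometry of triangular maps of the plane -/

namespace TGL

lemma abs_sub_apply_le_dist (x y : Plane) (k : Fin 2) : |x k - y k| ≤ dist x y := by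
  rw [EuclideanSpace.dist_eq]
  refine Real.abs_le_sqrt ?_
  rw [← sq_abs, ← Real.dist_eq]
  exact Finset.single_le_sum (f := fun i => dist (x i) (y i) ^ 2) (fun i _ => sq_nonneg _)
    (Finset.mem_univ k)

lemma dist_le_abs_add_abs (x y : Plane) : dist x y ≤ |x 0 - y 0| + |x 1 - y 1| := by
  rw [EuclideanSpace.dist_eq, Fin.sum_univ_two, Real.dist_eq, Real.dist_eq]
  refine Real.sqrt_le_iff.2 ⟨by positivity, ?_⟩
  nlinarith [abs_nonneg (x 0 - y 0), abs_nonneg (x 1 - y 1)]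

section TriMap

variable {a b d a' b' d' : ℝ} {t t' : Plane}

@[simp] lemma triMap_apply_zero (x : Plane) : triMap a b d t x 0 = b * x 0 + t 0 := by
  simp [triMap]

@[simp] lemma triMap_apply_one (x : Plane) : triMap a b d t x 1 = d * x 0 + a * x 1 + t 1 := by
  simp [triMap]

lemma plane_ext {x y : Plane} (h0 : x 0 = y 0) (h1 : x 1 = y 1) : x = y := by
  ext k
  fin_cases k
  · exact h0
  · exact h1

lemma triMap_comp : triMap a b d t ∘ triMap a' b' d' t' =
    triMap (a * a') (b * b') (d * b' + a * d') (triMap a b d t t') := by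
  funext x
  refine plane_ext ?_ ?_ <;> simp <;> ring

lemma triMap_id : triMap 1 1 0 0 = id := by
  funext x
  refine plane_ext ?_ ?_ <;> simp

lemma triMap_injective (ha : 0 < a) (hb : 0 < b) : Function.Injective (triMap a b d t) := by
  intro x y h
  have h0 : x 0 = y 0 := by
    have := congrArg (fun z : Plane => z 0) h
    simpa [hb.ne'] using this
  refine plane_ext h0 ?_
  have := congrArg (fun z : Plane => z 1) h
  simpa [h0, ha.ne'] using this

lemma exists_mul_dist_le_dist_triMap (ha : 0 < a) (hb : 0 < b) :
    ∃ c > 0, ∀ x y, c * dist x y ≤ dist (triMap a b d t x) (triMap a b d t y) := by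
  set L : ℝ := 1 / b + |d| / (a * b) + 1 / a with hL
  have hL0 : 0 < L := by positivity
  refine ⟨1 / L, by positivity, fun x y => ?_⟩
  rw [one_div_mul_eq_div, div_le_iff₀ hL0]
  set δ := dist (triMap a b d t x) (triMap a b d t y) with hδ
  have h0 := abs_sub_apply_le_dist (triMap a b d t x) (triMap a b d t y) 0
  have h1 := abs_sub_apply_le_dist (triMap a b d t x) (triMap a b d t y) 1
  rw [← hδ] at h0 h1
  have e0 : |x 0 - y 0| ≤ δ / b := by
    have e : |x 0 - y 0| * b = |(x 0 - y 0) * b| := by rw [abs_mul, abs_of_pos hb]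
    rw [le_div_iff₀ hb, e]
    refine le_of_eq_of_le ?_ h0
    congr 1; simp; ring
  have e1 : |x 1 - y 1| ≤ (δ + |d| * (δ / b)) / a := by
    have e : |x 1 - y 1| * a = |(x 1 - y 1) * a| := by rw [abs_mul, abs_of_pos ha]
    rw [le_div_iff₀ ha, e]
    have e2 : (x 1 - y 1) * a = (triMap a b d t x 1 - triMap a b d t y 1) - d * (x 0 - y 0) := by
      simp; ring
    rw [e2]
    refine (abs_sub _ _).trans ?_
    rw [abs_mul]
    gcongr
  calc dist x y ≤ |x 0 - y 0| + |x 1 - y 1| := dist_le_abs_add_abs x y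
    _ ≤ δ / b + (δ + |d| * (δ / b)) / a := add_le_add e0 e1
    _ = δ * L := by rw [hL]; field_simp; ring

/-- A triangular map contracts vertical extents by `a`; horizontal extents, and the vertical
displacement caused by the shear, are governed by `b`. -/
lemma dist_triMap_le (ha : 0 ≤ a) (hb : 0 ≤ b) {D : ℝ} (hd : |d| ≤ D * b) (x y : Plane) :
    dist (triMap a b d t x) (triMap a b d t y) ≤
      (1 + D) * (b * |x 0 - y 0|) + a * |x 1 - y 1| := by
  refine (dist_le_abs_add_abs _ _).trans ?_
  have e0 : triMap a b d t x 0 - triMap a b d t y 0 = b * (x 0 - y 0) := by simp; ring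
  have e1 : triMap a b d t x 1 - triMap a b d t y 1 = d * (x 0 - y 0) + a * (x 1 - y 1) := by
    simp; ring
  rw [e0, e1, abs_mul, abs_of_nonneg hb]
  have h1 := abs_add_le (d * (x 0 - y 0)) (a * (x 1 - y 1))
  rw [abs_mul, abs_mul, abs_of_nonneg ha] at h1
  have h2 := mul_le_mul_of_nonneg_right hd (abs_nonneg (x 0 - y 0))
  linarith

/-- The coordinates of a point of the plane, as a pair. -/
def toPair (x : Plane) : ℝ × ℝ := (x 0, x 1)

lemma toPair_injective : Function.Injective toPair := fun _ _ h =>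
  plane_ext (congrArg Prod.fst h) (congrArg Prod.snd h)

/-- The closed coordinate square of side `2 ρ` centred at `z`. -/
def box (z : Plane) (ρ : ℝ) : Set (ℝ × ℝ) :=
  Icc (z 0 - ρ) (z 0 + ρ) ×ˢ Icc (z 1 - ρ) (z 1 + ρ)

lemma volume_box (z : Plane) {ρ : ℝ} (hρ : 0 ≤ ρ) :
    MeasureTheory.volume (box z ρ) = ENNReal.ofReal (4 * ρ ^ 2) := by
  rw [box, MeasureTheory.Measure.volume_eq_prod, MeasureTheory.Measure.prod_prod,
    Real.volume_Icc, Real.volume_Icc, ← ENNReal.ofReal_mul (by linarith)]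
  congr 1; ring

/-- The image of the open unit square is a parallelogram with two vertical sides of length `a`,
that is, the region between two parallel lines over an interval of length `b`. -/
lemma toPair_image_triMap_openSquare (ha : 0 < a) (hb : 0 < b) :
    toPair '' (triMap a b d t '' openSquare) =
      regionBetween (fun x => d / b * (x - t 0) + t 1) (fun x => d / b * (x - t 0) + t 1 + a)
        (Ioo (t 0) (t 0 + b)) := by
  ext ⟨X, Y⟩
  simp only [regionBetween, mem_ofPred_eq, mem_Ioo]
  constructor
  · rintro ⟨_, ⟨x, hx, rfl⟩, h⟩
    obtain ⟨h0, h1⟩ := Prod.mk.inj h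
    have hx0 := hx 0
    have hx1 := hx 1
    simp only [triMap_apply_zero, triMap_apply_one] at h0 h1
    have e : d / b * (X - t 0) = d * x 0 := by rw [← h0]; field_simp; ring
    rw [e, ← h0, ← h1]
    have i0 := mul_pos hb hx0.1
    have i1 := mul_lt_mul_of_pos_left hx0.2 hb
    have i2 := mul_pos ha hx1.1
    have i3 := mul_lt_mul_of_pos_left hx1.2 ha
    refine ⟨⟨?_, ?_⟩, ?_, ?_⟩ <;> linarith
  · rintro ⟨⟨h1, h2⟩, h3, h4⟩
    refine ⟨_, ⟨!₂[(X - t 0) / b, (Y - t 1 - d / b * (X - t 0)) / a], ?_, rfl⟩, ?_⟩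
    · intro k
      fin_cases k
      · refine ⟨div_pos (by linarith) hb, ?_⟩
        change (X - t 0) / b < 1
        rw [div_lt_one hb]; linarith
      · refine ⟨div_pos (by linarith) ha, ?_⟩
        change (Y - t 1 - d / b * (X - t 0)) / a < 1
        rw [div_lt_one ha]; linarith
    · refine Prod.ext ?_ ?_
      · simp [toPair]; field_simp; ring
      · simp [toPair]; field_simp; ring

lemma measurableSet_strip {α β : ℝ} : MeasurableSet
    (regionBetween (fun x => d / b * (x - t 0) + t 1) (fun x => d / b * (x - t 0) + t 1 + a)
      (Ioo α β)) :=
  measurableSet_regionBetween (by fun_prop) (by fun_prop) measurableSet_Ioo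

lemma volume_strip {α β : ℝ} : MeasureTheory.volume
    (regionBetween (fun x => d / b * (x - t 0) + t 1) (fun x => d / b * (x - t 0) + t 1 + a)
      (Ioo α β)) = ENNReal.ofReal a * ENNReal.ofReal (β - α) := by
  rw [MeasureTheory.Measure.volume_eq_prod, volume_regionBetween_eq_lintegral
    (Measurable.aemeasurable (by fun_prop)) (Measurable.aemeasurable (by fun_prop))
    measurableSet_Ioo]
  simp

/-- A cell of height comparable to `δ` that has a point near `z` (possibly on its boundary, or
even outside it in the vertical direction at bounded relative distance) fills a definite
proportion of the square of size a multiple of `δ` around `z`. -/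
lemma le_volume_cell_inter_box {D R m δ : ℝ} {p z : Plane} (hm0 : 0 < m) (hδ : 0 < δ)
    (hm1 : m ≤ 1) (hma : m * δ < a) (haδ : a ≤ δ) (hab : a ≤ b) (hD : 0 ≤ D)
    (hd : |d| ≤ D * b) (hp0 : p 0 ∈ Icc (0 : ℝ) 1) (hp1 : |p 1| ≤ R)
    (hz : dist (triMap a b d t p) z ≤ δ) :
    ENNReal.ofReal (m ^ 2 * δ ^ 2) ≤ MeasureTheory.volume
      (toPair '' (triMap a b d t '' openSquare) ∩ box z ((2 + D + R) * δ)) := by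
  have ha : 0 < a := (by positivity : 0 < m * δ).trans hma
  have hb : 0 < b := ha.trans_le hab
  have hR : 0 ≤ R := (abs_nonneg _).trans hp1
  rw [toPair_image_triMap_openSquare ha hb]
  -- a window of relative width `m δ / b` inside `(0, 1)` whose closure contains `p 0`
  set l : ℝ := m * δ / b with hl
  have hbl : b * l = m * δ := by rw [hl]; field_simp
  have hl0 : 0 < l := by positivity
  have hl1 : l ≤ 1 := by rw [hl, div_le_one hb]; linarith
  set α : ℝ := t 0 + b * (p 0 * (1 - l)) with hα
  have hsub : regionBetween (fun x => d / b * (x - t 0) + t 1)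
      (fun x => d / b * (x - t 0) + t 1 + a) (Ioo α (α + m * δ)) ⊆
      regionBetween (fun x => d / b * (x - t 0) + t 1) (fun x => d / b * (x - t 0) + t 1 + a)
        (Ioo (t 0) (t 0 + b)) ∩ box z ((2 + D + R) * δ) := by
    rintro ⟨X, Y⟩ ⟨⟨hX1, hX2⟩, hY1, hY2⟩
    simp only at hX1 hX2 hY1 hY2
    have h0 : 0 ≤ b * (p 0 * (1 - l)) :=
      mul_nonneg hb.le (mul_nonneg hp0.1 (by linarith))
    have h1 : b * (p 0 * (1 - l)) + m * δ ≤ b := by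
      rw [← hbl, ← mul_add]
      refine mul_le_of_le_one_right hb.le ?_
      nlinarith [hp0.2]
    have hz0 := (abs_sub_apply_le_dist (triMap a b d t p) z 0).trans hz
    have hz1 := (abs_sub_apply_le_dist (triMap a b d t p) z 1).trans hz
    simp only [triMap_apply_zero, triMap_apply_one] at hz0 hz1
    have hmδ : m * δ ≤ δ := mul_le_of_le_one_left hδ.le hm1
    have hXp : |X - t 0 - b * p 0| ≤ m * δ := by
      have e : b * (p 0 * (1 - l)) = b * p 0 - p 0 * (m * δ) := by rw [← hbl]; ring
      have i1 : p 0 * (m * δ) ≤ m * δ := mul_le_of_le_one_left (by positivity) hp0.2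
      have i2 : 0 ≤ p 0 * (m * δ) := mul_nonneg hp0.1 (by positivity)
      rw [abs_le]
      constructor <;> linarith
    have hshear : |d / b * (X - t 0) - d * p 0| ≤ D * δ := by
      have e : d / b * (X - t 0) - d * p 0 = d / b * (X - t 0 - b * p 0) := by field_simp
      rw [e, abs_mul, abs_div, abs_of_pos hb]
      have i1 : |d| / b ≤ D := by rwa [div_le_iff₀ hb]
      exact mul_le_mul i1 (hXp.trans hmδ) (abs_nonneg _) hD
    have hheight : |a * p 1| ≤ R * δ := by
      rw [abs_mul, abs_of_pos ha, mul_comm]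
      exact mul_le_mul hp1 haδ ha.le hR
    have hDδ : 0 ≤ D * δ := by positivity
    have hRδ : 0 ≤ R * δ := by positivity
    rw [abs_le] at hz0 hz1 hXp hshear hheight
    refine ⟨⟨⟨?_, ?_⟩, hY1, hY2⟩, ⟨?_, ?_⟩, ?_, ?_⟩ <;> simp only <;> linarith
  refine le_trans ?_ (MeasureTheory.measure_mono hsub)
  rw [volume_strip, add_sub_cancel_left, ← ENNReal.ofReal_mul ha.le]
  refine ENNReal.ofReal_le_ofReal ?_
  calc m ^ 2 * δ ^ 2 = (m * δ) * (m * δ) := by ring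
    _ ≤ a * (m * δ) := mul_le_mul_of_nonneg_right hma.le (by positivity)

end TriMap

/-- The number of separated points of an image `f '' Λ` is controlled through any other map `π`
of `Λ` that separates points whenever `f` does. -/
lemma sep_image_le_sep {X Y Z : Type*} [PseudoMetricSpace Y] [PseudoMetricSpace Z] {Λ : Set X}
    {G : Set Z} {δ ε : ℝ} (hδ : 0 ≤ δ) (hε : 0 ≤ ε) (f : X → Y) (π : X → Z) (hπ : MapsTo π Λ G)
    (hne : Λ.Nonempty)
    (h : ∀ x ∈ Λ, ∀ y ∈ Λ, δ < dist (f x) (f y) → ε < dist (π x) (π y)) :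
    sep δ (f '' Λ) ≤ sep ε G := by
  have : Nonempty X := ⟨hne.some⟩
  have hmem : ∀ q ∈ f '' Λ, Function.invFunOn f Λ q ∈ Λ ∧ f (Function.invFunOn f Λ q) = q :=
    fun q hq => ⟨Function.invFunOn_mem hq, Function.invFunOn_eq hq⟩
  refine sep_le_sep_of_map hδ hε (fun q => π (Function.invFunOn f Λ q))
    (fun q hq => hπ (hmem q hq).1) fun q hq q' hq' hqq => ?_
  refine h _ (hmem q hq).1 _ (hmem q' hq').1 ?_
  rwa [(hmem q hq).2, (hmem q' hq').2]

lemma rpow_abs_le_rpow {m ρ : ℝ} (hm0 : 0 < m) (hmρ : m ≤ ρ) (hρ : ρ ≤ 1) (y : ℝ) :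
    m ^ |y| ≤ ρ ^ y := by
  have hρ0 := hm0.trans_le hmρ
  calc m ^ |y| ≤ ρ ^ |y| := Real.rpow_le_rpow hm0.le hmρ (abs_nonneg y)
    _ ≤ ρ ^ y := Real.rpow_le_rpow_of_exponent_ge hρ0 hρ (le_abs_self y)

lemma rpow_abs_mul_rpow_le_one {m ρ : ℝ} (hm0 : 0 < m) (hmρ : m ≤ ρ) (hρ : ρ ≤ 1) (y : ℝ) :
    m ^ |y| * ρ ^ y ≤ 1 := by
  have hρ0 := hm0.trans_le hmρ
  have h := rpow_abs_le_rpow hm0 hmρ hρ (-y)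
  rw [abs_neg, Real.rpow_neg hρ0.le] at h
  rwa [← le_inv_mul_iff₀' (Real.rpow_pos_of_pos hρ0 y), mul_one]

end TGL

/-! ### Cylinders of a shifted triangular Gatzouras--Lalley-type carpet -/

namespace TGL

namespace ShiftedTGL

variable {N M : ℕ}

lemma nonempty_columns (F : ShiftedTGL N M) : Nonempty (Fin M) := ⟨⟨0, one_pos.trans F.one_lt_M⟩⟩

lemma nonempty_maps (F : ShiftedTGL N M) : Nonempty (Fin N) :=
  F.nonempty_columns.map fun j => (F.column_surjective j).choose

variable (F : ShiftedTGL N M) {Λ : Set Plane} {ΛH : Set ℝ}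

lemma b_pos (i : Fin N) : 0 < F.b i := (F.a_pos i).trans (F.a_lt_b i)

lemma a_lt_one (i : Fin N) : F.a i < 1 := (F.a_lt_b i).trans (F.b_lt_one i)

lemma r_pos (j : Fin M) : 0 < F.r j := by
  obtain ⟨i, rfl⟩ := F.column_surjective j
  exact F.b_eq i ▸ F.b_pos i

lemma r_lt_one (j : Fin M) : F.r j < 1 := by
  obtain ⟨i, rfl⟩ := F.column_surjective j
  exact F.b_eq i ▸ F.b_lt_one i

lemma columnMap_eq_lineMap : F.columnMap = lineMap F.r F.u := rfl

/-- The column system with each column map repeated once for every map of the column has the same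
attractor. -/
lemma isAttractor_lineMap_b (hΛH : IsAttractor F.columnMap ΛH) :
    IsAttractor (lineMap F.b fun i => F.t i 0) ΛH := by
  refine ⟨hΛH.1, hΛH.2.1, ?_⟩
  have : (lineMap F.b fun i => F.t i 0) = fun i => F.columnMap (F.column i) := by
    funext i x
    simp [lineMap, columnMap, F.b_eq, F.t_eq]
  rw [this, F.column_surjective.iUnion_comp fun j => F.columnMap j '' ΛH]
  exact hΛH.2.2

lemma isAttractor_image_fst (hΛ : IsAttractor F.map Λ) :
    IsAttractor (lineMap F.b fun i => F.t i 0) ((fun z : Plane => z 0) '' Λ) := by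
  refine ⟨hΛ.1.image _, hΛ.2.1.image (by fun_prop), ?_⟩
  conv_lhs => rw [hΛ.2.2]
  rw [image_iUnion]
  refine iUnion_congr fun i => ?_
  rw [image_image, image_image]
  refine image_congr fun z _ => ?_
  simp [map, lineMap]

lemma image_fst_eq (hΛ : IsAttractor F.map Λ) (hΛH : IsAttractor F.columnMap ΛH) :
    (fun z : Plane => z 0) '' Λ = ΛH := by
  have := F.nonempty_maps
  have h1 := F.isAttractor_image_fst hΛ
  have h2 := F.isAttractor_lineMap_b hΛH
  exact Subset.antisymm
    (h1.subset_of_mapsTo F.b_pos F.b_lt_one h2.2.1 h2.1 h2.mapsTo)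
    (h2.subset_of_mapsTo F.b_pos F.b_lt_one h1.2.1 h1.1 h1.mapsTo)

lemma columnAttractor_subset_Icc (hΛH : IsAttractor F.columnMap ΛH) : ΛH ⊆ Icc 0 1 := by
  have := F.nonempty_maps
  refine (F.isAttractor_lineMap_b hΛH).subset_of_mapsTo F.b_pos F.b_lt_one isCompact_Icc
    ⟨0, by simp⟩ fun i x hx => ?_
  have h : (!₂[x, 0] : Plane) ∈ unitSquare := by
    intro k
    fin_cases k
    · exact hx
    · simp
  simpa [lineMap] using F.mapsTo_unitSquare i h 0

/-- Every composition of maps of the system is triangular, with the diagonal entries multiplying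
along the word; the off-diagonal entry stays bounded by a constant times `b - a`, a bound that is
preserved by composition and says that the shear of a cylinder is at most comparable to its
width. -/
lemma exists_wordMap_eq_triMap : ∃ D ≥ 0, ∀ w : List (Fin N), ∃ d t,
    |d| ≤ D * (wt F.b w - wt F.a w) ∧ wordMap F.map w = triMap (wt F.a w) (wt F.b w) d t := by
  have := F.nonempty_maps
  have hpos : ∀ i, 0 < F.b i - F.a i := fun i => sub_pos.2 (F.a_lt_b i)
  obtain ⟨j, hj⟩ := Finite.exists_max fun i => |F.d i| / (F.b i - F.a i)
  set D := |F.d j| / (F.b j - F.a j) with hD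
  have hD0 : 0 ≤ D := div_nonneg (abs_nonneg _) (hpos j).le
  have hDi : ∀ i, |F.d i| ≤ D * (F.b i - F.a i) := fun i => (div_le_iff₀ (hpos i)).1 (hj i)
  refine ⟨D, hD0, fun w => ?_⟩
  induction w with
  | nil => exact ⟨0, 0, by simp, by simp [wordMap, triMap_id]⟩
  | cons i w ih =>
    obtain ⟨d, t, hd, hw⟩ := ih
    refine ⟨d * F.b i + wt F.a w * F.d i, triMap (wt F.a w) (wt F.b w) d t (F.t i), ?_, ?_⟩
    · have ha := wt_pos F.a_pos w
      have h1 := abs_add_le (d * F.b i) (wt F.a w * F.d i)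
      rw [abs_mul, abs_mul, abs_of_pos (F.b_pos i), abs_of_pos ha] at h1
      have h2 := mul_le_mul_of_nonneg_right hd (F.b_pos i).le
      have h3 := mul_le_mul_of_nonneg_left (hDi i) ha.le
      rw [wt_cons, wt_cons]
      linarith
    · simp only [wordMap, hw]
      rw [show F.map i = triMap (F.a i) (F.b i) (F.d i) (F.t i) from rfl, triMap_comp, wt_cons,
        wt_cons, mul_comm (F.a i), mul_comm (F.b i)]

/-- Every neighbourhood of a point of the carpet contains a whole cylinder, which is a copy of the
carpet under an invertible affine map. -/
lemma exists_cylinder_in_ball (hΛ : IsAttractor F.map Λ) (x : Plane) (hx : x ∈ Λ) (ε : ℝ)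
    (hε : 0 < ε) : ∃ g : Plane → Plane, MapsTo g Λ (Λ ∩ Metric.ball x ε) ∧
      ∃ c > 0, ∀ y z, c * dist y z ≤ dist (g y) (g z) := by
  have := F.nonempty_maps
  obtain ⟨D, hD0, hD⟩ := F.exists_wordMap_eq_triMap
  obtain ⟨m, hm0, hm1, hm⟩ := exists_lower_weight F.b_pos F.b_lt_one
  obtain ⟨R, hR⟩ := hΛ.2.1.isBounded.subset_closedBall x
  set L : ℝ := (2 + D) * |R| + 1 with hL
  have hL0 : 0 < L := by positivity
  obtain ⟨w, ⟨z, hz, rfl⟩, -, hw⟩ := hΛ.exists_word hm0 hm1 hm F.b_lt_one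
    (lt_min one_pos (by positivity : 0 < ε / (2 * L))) (min_le_left _ _) hx
  have hw := hw.trans (min_le_right _ _)
  obtain ⟨d, t, hd, hwd⟩ := hD w
  have ha := wt_pos F.a_pos w
  have hb := wt_pos F.b_pos w
  have hab := wt_le_wt F.a_pos (fun i => (F.a_lt_b i).le) w
  have hd' : |d| ≤ D * wt F.b w :=
    hd.trans (mul_le_mul_of_nonneg_left (by linarith) hD0)
  refine ⟨wordMap F.map w, fun y hy => ⟨mapsTo_wordMap hΛ.mapsTo w hy, ?_⟩, ?_⟩
  · rw [Metric.mem_ball, hwd]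
    have hdist : ∀ k, |y k - z k| ≤ 2 * |R| := fun k => by
      refine (abs_sub_apply_le_dist y z k).trans ((dist_triangle_right y z
        (wordMap F.map w z)).trans ?_)
      have h1 := Metric.mem_closedBall.1 (hR hy)
      have h2 := Metric.mem_closedBall.1 (hR hz)
      linarith [le_abs_self R]
    refine (dist_triMap_le ha.le hb.le hd' y z).trans_lt ?_
    calc (1 + D) * (wt F.b w * |y 0 - z 0|) + wt F.a w * |y 1 - z 1|
        ≤ (1 + D) * (wt F.b w * (2 * |R|)) + wt F.b w * (2 * |R|) := by
          gcongr
          · exact hdist 0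
          · exact hdist 1
      _ = wt F.b w * (2 * ((2 + D) * |R|)) := by ring
      _ < wt F.b w * (2 * L) := by
          refine mul_lt_mul_of_pos_left ?_ hb
          linarith
      _ ≤ ε / (2 * L) * (2 * L) := by gcongr
      _ = ε := by field_simp
  · rw [hwd]
    exact exists_mul_dist_le_dist_triMap ha hb

/-! ### Upper bound, regardless of overlaps -/

/-- The weights `bᵢ ^ sH * aᵢ ^ (s - sH)`. -/
noncomputable def weight (sH s : ℝ) (i : Fin N) : ℝ := F.b i ^ sH * F.a i ^ (s - sH)

lemma weight_pos (sH s : ℝ) (i : Fin N) : 0 < F.weight sH s i :=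
  mul_pos (Real.rpow_pos_of_pos (F.b_pos i) _) (Real.rpow_pos_of_pos (F.a_pos i) _)

lemma wt_weight (sH s : ℝ) (w : List (Fin N)) :
    wt (F.weight sH s) w = wt F.b w ^ sH * wt F.a w ^ (s - sH) := by
  unfold weight
  rw [wt_mul (fun i => F.b i ^ sH), wt_rpow F.b_pos, wt_rpow F.a_pos]

/-- If the column attractor has at most `C δ ^ (-sH)` points that are `δ`-separated, then the
carpet has upper box dimension at most `s`. A cylinder of height about `δ` and width `b` projects
to a copy of the column attractor scaled by `b`, and so needs about `(b / δ) ^ sH` balls of radius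
`δ`; the weights of the cylinders sum to one. -/
lemma upperBoxDim_le (hΛ : IsAttractor F.map Λ) (hproj : (fun z : Plane => z 0) '' Λ = ΛH)
    {C sH s : ℝ} (hC0 : 0 < C)
    (hC : ∀ δ ∈ Ioc (0 : ℝ) 1, sep δ ΛH ≤ ENNReal.ofReal (C * δ ^ (-sH)))
    (hs : ∑ i, F.weight sH s i = 1) : upperBoxDim Λ ≤ s := by
  have := F.nonempty_maps
  obtain ⟨D, hD0, hD⟩ := F.exists_wordMap_eq_triMap
  obtain ⟨m, hm0, hm1, hm⟩ := exists_lower_weight F.a_pos F.a_lt_one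
  obtain ⟨R, hR0, hR⟩ : ∃ R ≥ 0, ∀ x ∈ Λ, ∀ y ∈ Λ, dist x y ≤ R := by
    obtain ⟨R, hR⟩ := Metric.isBounded_iff.1 hΛ.2.1.isBounded
    exact ⟨|R|, abs_nonneg R, fun x hx y hy => (hR hx hy).trans (le_abs_self R)⟩
  set k : ℝ := 1 + D + R with hk
  have hk0 : 0 < k := by positivity
  have hm' : 0 < m ^ |s - sH| := Real.rpow_pos_of_pos hm0 _
  refine upperBoxDim_le_of_cov_le (k := k) (C := C * m ^ (-sH) * (m ^ |s - sH|)⁻¹) hk0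
    fun δ hδ => ?_
  have hδ0 := hδ.1
  set κ : ℝ := C * m ^ (-sH) * (m ^ |s - sH|)⁻¹ * δ ^ (-s) with hκ
  have hκ0 : 0 ≤ κ := by positivity
  have key : sep (k * δ) (wordMap F.map [] '' Λ) ≤
      ENNReal.ofReal (κ * wt (F.weight sH s) []) := by
    refine tree_induction (P := fun w => sep (k * δ) (wordMap F.map w '' Λ) ≤
      ENNReal.ofReal (κ * wt (F.weight sH s) w)) hm0 hm1 hm F.a_lt_one hδ0 hδ.2.le ?_ ?_
    · intro w h1 h2
      obtain ⟨d, t, hd, hwd⟩ := hD w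
      have ha := wt_pos F.a_pos w
      have hb := wt_pos F.b_pos w
      have hab := wt_le_wt F.a_pos (fun i => (F.a_lt_b i).le) w
      have hd' : |d| ≤ D * wt F.b w :=
        hd.trans (mul_le_mul_of_nonneg_left (by linarith) hD0)
      have hρ : m * δ / wt F.b w ∈ Ioc (0 : ℝ) 1 :=
        ⟨by positivity, (div_le_one hb).2 (h1.le.trans hab)⟩
      have hsep : sep (k * δ) (wordMap F.map w '' Λ) ≤ sep (m * δ / wt F.b w) ΛH := by
        refine sep_image_le_sep (by positivity) hρ.1.le _ (fun z : Plane => z 0)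
          (fun z hz => hproj ▸ mem_image_of_mem _ hz) hΛ.1 fun x hx y hy hxy => ?_
        by_contra! hle
        rw [Real.dist_eq, le_div_iff₀ hb] at hle
        rw [hwd] at hxy
        refine hxy.not_ge ((dist_triMap_le ha.le hb.le hd' x y).trans ?_)
        have i1 : wt F.b w * |x 0 - y 0| ≤ δ := by
          rw [mul_comm]
          exact hle.trans (mul_le_of_le_one_left hδ0.le hm1.le)
        have i2 : wt F.a w * |x 1 - y 1| ≤ δ * R :=
          mul_le_mul h2 ((abs_sub_apply_le_dist x y 1).trans (hR x hx y hy)) (abs_nonneg _) hδ0.le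
        have i3 := mul_le_mul_of_nonneg_left i1 (by positivity : 0 ≤ 1 + D)
        rw [hk]; linarith
      refine hsep.trans ((hC _ hρ).trans (ENNReal.ofReal_le_ofReal ?_))
      have hratio : m ^ |s - sH| ≤ (wt F.a w / δ) ^ (s - sH) :=
        rpow_abs_le_rpow hm0 ((le_div_iff₀ hδ0).2 h1.le) ((div_le_one hδ0).2 h2) _
      rw [wt_weight, Real.div_rpow (by positivity) hb.le, Real.mul_rpow hm0.le hδ0.le, hκ]
      rw [Real.div_rpow ha.le hδ0.le, le_div_iff₀ (by positivity)] at hratio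
      have e1 : δ ^ (-sH) = δ ^ (-s) * δ ^ (s - sH) := by
        rw [← Real.rpow_add hδ0]; ring_nf
      rw [e1, Real.rpow_neg hb.le, div_inv_eq_mul]
      calc C * (m ^ (-sH) * (δ ^ (-s) * δ ^ (s - sH)) * wt F.b w ^ sH)
          = C * m ^ (-sH) * (m ^ |s - sH|)⁻¹ * δ ^ (-s) * wt F.b w ^ sH *
            (m ^ |s - sH| * δ ^ (s - sH)) := by field_simp
        _ ≤ C * m ^ (-sH) * (m ^ |s - sH|)⁻¹ * δ ^ (-s) * wt F.b w ^ sH *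
            wt F.a w ^ (s - sH) := by gcongr
        _ = _ := by ring
    · intro w _ ih
      rw [hΛ.image_wordMap]
      refine (sep_iUnion_le (by positivity) _).trans
        ((Finset.sum_le_sum fun i _ => ih i).trans_eq ?_)
      rw [sum_ofReal_mul_wt_cons (F.weight_pos sH s) hκ0, hs, one_mul]
  have key' : sep (k * δ) Λ ≤ ENNReal.ofReal κ := by simpa [wordMap] using key
  exact cov_le_sep.trans key'

/-! ### Lower bound under the rectangular open set condition -/

/-- The open parallelogram of a word: the image of the open unit square. -/
def cell (w : List (Fin N)) : Set (ℝ × ℝ) := toPair '' (wordMap F.map w '' openSquare)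

lemma measurableSet_cell (w : List (Fin N)) : MeasurableSet (F.cell w) := by
  obtain ⟨D, -, hD⟩ := F.exists_wordMap_eq_triMap
  obtain ⟨d, t, -, hwd⟩ := hD w
  rw [cell, hwd, toPair_image_triMap_openSquare (wt_pos F.a_pos w) (wt_pos F.b_pos w)]
  exact measurableSet_strip

lemma map_injective (i : Fin N) : Function.Injective (F.map i) :=
  triMap_injective (F.a_pos i) (F.b_pos i)

variable {F}

/-- Under the rectangular open set condition the cells of the children of a word are disjoint and
contained in its cell, so any measure is superadditive along the tree of cells. -/
lemma ROSC.sum_measure_cell_le (h : F.ROSC Λ) (μ : MeasureTheory.Measure (ℝ × ℝ))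
    (w : List (Fin N)) : ∑ i, μ (F.cell (i :: w)) ≤ μ (F.cell w) := by
  have hinj : Function.Injective (toPair ∘ wordMap F.map w) :=
    toPair_injective.comp (wordMap_injective F.map_injective w)
  have hcell : ∀ i, F.cell (i :: w) = (toPair ∘ wordMap F.map w) '' (F.map i '' openSquare) := by
    intro i
    simp only [cell, wordMap, image_comp]
  rw [← tsum_fintype (L := .unconditional _), ← MeasureTheory.measure_iUnion ?_
    fun i => F.measurableSet_cell _]
  · refine MeasureTheory.measure_mono (iUnion_subset fun i => ?_)
    rw [hcell, cell, ← image_comp toPair (wordMap F.map w)]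
    exact image_mono ((subset_iUnion (fun i => F.map i '' openSquare) i).trans h.2.1)
  · intro i j hij
    simp only [Function.onFun, hcell]
    exact (disjoint_image_iff hinj).2 (h.2.2 i j hij)

/-- A power law from below for the column attractor gives a lower bound for the box dimension of
the carpet under the rectangular open set condition. For a minimal cover by balls of radius about
`δ`, consider the measure that counts the balls through Lebesgue measure on squares around their
centres. It has mass about `δ ^ 2` times the number of balls, is superadditive along the tree of
cells, and gives a cell of height about `δ` at least `δ ^ 2` for every ball that meets the cylinder;
projecting the cylinder to the axis shows that there are about `(b / δ) ^ sH` such balls. -/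
lemma ROSC.le_lowerBoxDim (h : F.ROSC Λ) (hΛ : IsAttractor F.map Λ)
    (hproj : (fun z : Plane => z 0) '' Λ = ΛH) (hIcc : ΛH ⊆ Icc 0 1) {sH s : ℝ}
    (hlow : ∀ ε > 0, ∃ c > 0, ∀ δ ∈ Ioc (0 : ℝ) 1,
      ENNReal.ofReal (c * δ ^ (-(sH - ε))) ≤ sep δ ΛH)
    (hs : ∑ i, F.weight sH s i = 1) : (s : EReal) ≤ lowerBoxDim Λ := by
  classical
  refine le_lowerBoxDim_of_forall_pos fun ε hε => ?_
  obtain ⟨c, hc0, hc⟩ := hlow ε hε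
  have := F.nonempty_maps
  obtain ⟨D, hD0, hD⟩ := F.exists_wordMap_eq_triMap
  obtain ⟨m, hm0, hm1, hm⟩ := exists_lower_weight F.a_pos F.a_lt_one
  obtain ⟨R, hR0, hR⟩ : ∃ R ≥ 0, ∀ x ∈ Λ, |x 1| ≤ R := by
    obtain ⟨R, hR⟩ := hΛ.2.1.isBounded.subset_closedBall (0 : Plane)
    refine ⟨|R|, abs_nonneg R, fun x hx => ?_⟩
    have h1 := abs_sub_apply_le_dist x 0 1
    have h2 := Metric.mem_closedBall.1 (hR hx)
    simp only [PiLp.zero_apply, sub_zero] at h1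
    linarith [le_abs_self R]
  set k : ℝ := 2 + D + R with hk
  have hk0 : 0 < k := by positivity
  set σ : ℝ := sH - ε with hσ
  set A : ℝ := c * m ^ (-σ) * m ^ 2 * m ^ |s - sH| with hA
  have hA0 : 0 < A := by positivity
  refine le_lowerBoxDim_of_le_cov (k := m / 2) (c := A / (4 * k ^ 2)) (by positivity)
    (by positivity) fun δ hδ => ?_
  have hδ0 := hδ.1
  by_cases hfin : cov (m / 2 * δ) Λ = ∞
  · rw [hfin]; exact le_top
  obtain ⟨S, hS, hScard⟩ := exists_finset_card_eq_cov (by positivity) hfin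
  set μ : MeasureTheory.Measure (ℝ × ℝ) :=
    ∑ z ∈ S, MeasureTheory.volume.restrict (box z (k * δ)) with hμ
  have hμcell : ∀ w, μ (F.cell w) =
      ∑ z ∈ S, MeasureTheory.volume (F.cell w ∩ box z (k * δ)) := by
    intro w
    rw [hμ, MeasureTheory.Measure.finsetSum_apply]
    exact Finset.sum_congr rfl fun z _ =>
      MeasureTheory.Measure.restrict_apply (F.measurableSet_cell w)
  set κ : ℝ := A * δ ^ 2 * δ ^ (-(s - ε)) with hκ
  have hκ0 : 0 ≤ κ := by positivity
  have key : ENNReal.ofReal (κ * wt (F.weight sH s) []) ≤ μ (F.cell []) := by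
    refine tree_induction (P := fun w => ENNReal.ofReal (κ * wt (F.weight sH s) w) ≤
      μ (F.cell w)) hm0 hm1 hm F.a_lt_one hδ0 hδ.2.le ?_ ?_
    · intro w h1 h2
      obtain ⟨d, t, hd, hwd⟩ := hD w
      have ha := wt_pos F.a_pos w
      have hb := wt_pos F.b_pos w
      have hb1 := wt_le_one F.b_pos F.b_lt_one w
      have hab := wt_le_wt F.a_pos (fun i => (F.a_lt_b i).le) w
      have hd' : |d| ≤ D * wt F.b w :=
        hd.trans (mul_le_mul_of_nonneg_left (by linarith) hD0)
      have hρ : m * δ / wt F.b w ∈ Ioc (0 : ℝ) 1 :=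
        ⟨by positivity, (div_le_one hb).2 (h1.le.trans hab)⟩
      -- the balls of the cover that meet the cylinder
      set T := S.filter fun z =>
        (Metric.closedBall z (m / 2 * δ) ∩ wordMap F.map w '' Λ).Nonempty with hT
      have hTcard : ENNReal.ofReal (c * (m * δ / wt F.b w) ^ (-σ)) ≤ (T.card : ℝ≥0∞) := by
        have hcov : wordMap F.map w '' Λ ⊆ ⋃ z ∈ T, Metric.closedBall z (m / 2 * δ) := by
          rintro _ ⟨x, hx, rfl⟩
          have hmem := hS (mapsTo_wordMap hΛ.mapsTo w hx)
          simp only [mem_iUnion, exists_prop] at hmem ⊢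
          obtain ⟨z, hz, hxz⟩ := hmem
          exact ⟨z, Finset.mem_filter.2 ⟨hz, _, hxz, mem_image_of_mem _ hx⟩, hxz⟩
        have hsep : sep (m * δ / wt F.b w) ΛH ≤
            sep (2 * (m / 2 * δ)) (wordMap F.map w '' Λ) := by
          rw [← hproj]
          refine sep_image_le_sep hρ.1.le (by positivity) _ (wordMap F.map w)
            (mapsTo_image _ _) hΛ.1 fun x _ y _ hxy => ?_
          rw [Real.dist_eq, div_lt_iff₀ hb] at hxy
          rw [hwd]
          refine lt_of_lt_of_le ?_ (abs_sub_apply_le_dist _ _ 0)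
          have e : triMap (wt F.a w) (wt F.b w) d t x 0 - triMap (wt F.a w) (wt F.b w) d t y 0
              = (x 0 - y 0) * wt F.b w := by simp; ring
          rw [e, abs_mul, abs_of_pos hb]
          linarith
        exact (hc _ hρ).trans (hsep.trans (sep_two_mul_le_cov.trans
          (cov_le_card (by positivity) T hcov)))
      have hcell : ∀ z ∈ T, ENNReal.ofReal (m ^ 2 * δ ^ 2) ≤
          MeasureTheory.volume (F.cell w ∩ box z (k * δ)) := by
        intro z hz
        obtain ⟨-, _, hball, p, hp, rfl⟩ := Finset.mem_filter.1 hz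
        rw [hwd] at hball
        rw [cell, hwd]
        refine le_volume_cell_inter_box hm0 hδ0 hm1.le h1 h2 hab hD0 hd'
          (hIcc (hproj ▸ mem_image_of_mem _ hp)) (hR p hp) ((Metric.mem_closedBall.1 hball).trans ?_)
        exact mul_le_of_le_one_left hδ0.le (by linarith)
      have hreal : κ * wt (F.weight sH s) w ≤
          c * (m * δ / wt F.b w) ^ (-σ) * (m ^ 2 * δ ^ 2) := by
        have hratio : m ^ |s - sH| * (wt F.a w / δ) ^ (s - sH) ≤ 1 :=
          rpow_abs_mul_rpow_le_one hm0 ((le_div_iff₀ hδ0).2 h1.le) ((div_le_one hδ0).2 h2) _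
        rw [Real.div_rpow ha.le hδ0.le, ← mul_div_assoc, div_le_one (by positivity)] at hratio
        have hbσ : wt F.b w ^ sH ≤ wt F.b w ^ σ :=
          Real.rpow_le_rpow_of_exponent_ge hb hb1 (by linarith)
        rw [wt_weight, Real.div_rpow (by positivity) hb.le, Real.mul_rpow hm0.le hδ0.le,
          Real.rpow_neg hb.le, div_inv_eq_mul, hκ, hA]
        have e1 : δ ^ (-σ) = δ ^ (-(s - ε)) * δ ^ (s - sH) := by
          rw [← Real.rpow_add hδ0, hσ]; ring_nf
        rw [e1]
        calc c * m ^ (-σ) * m ^ 2 * m ^ |s - sH| * δ ^ 2 * δ ^ (-(s - ε)) *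
              (wt F.b w ^ sH * wt F.a w ^ (s - sH))
            = c * m ^ (-σ) * m ^ 2 * δ ^ 2 * δ ^ (-(s - ε)) * wt F.b w ^ sH *
              (m ^ |s - sH| * wt F.a w ^ (s - sH)) := by ring
          _ ≤ c * m ^ (-σ) * m ^ 2 * δ ^ 2 * δ ^ (-(s - ε)) * wt F.b w ^ σ *
              δ ^ (s - sH) := by gcongr
          _ = _ := by ring
      rw [hμcell]
      calc ENNReal.ofReal (κ * wt (F.weight sH s) w)
          ≤ ENNReal.ofReal (c * (m * δ / wt F.b w) ^ (-σ) * (m ^ 2 * δ ^ 2)) :=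
            ENNReal.ofReal_le_ofReal hreal
        _ = ENNReal.ofReal (c * (m * δ / wt F.b w) ^ (-σ)) *
              ENNReal.ofReal (m ^ 2 * δ ^ 2) := ENNReal.ofReal_mul (by positivity)
        _ ≤ T.card * ENNReal.ofReal (m ^ 2 * δ ^ 2) := by gcongr
        _ = ∑ _z ∈ T, ENNReal.ofReal (m ^ 2 * δ ^ 2) := by rw [Finset.sum_const, nsmul_eq_mul]
        _ ≤ ∑ z ∈ T, MeasureTheory.volume (F.cell w ∩ box z (k * δ)) :=
            Finset.sum_le_sum hcell
        _ ≤ ∑ z ∈ S, MeasureTheory.volume (F.cell w ∩ box z (k * δ)) :=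
            Finset.sum_le_sum_of_subset (Finset.filter_subset _ _)
    · intro w _ ih
      refine le_trans ?_ (h.sum_measure_cell_le μ w)
      refine le_trans (le_of_eq ?_) (Finset.sum_le_sum fun i _ => ih i)
      rw [sum_ofReal_mul_wt_cons (F.weight_pos sH s) hκ0, hs, one_mul]
  have hmass : μ (F.cell []) ≤ cov (m / 2 * δ) Λ * ENNReal.ofReal (4 * (k * δ) ^ 2) := by
    rw [hμcell, ← hScard, ← nsmul_eq_mul]
    refine Finset.sum_le_card_nsmul _ _ _ fun z _ => ?_
    rw [← volume_box z (by positivity)]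
    exact MeasureTheory.measure_mono inter_subset_right
  have hfinal := key.trans hmass
  have hpos : 0 < 4 * (k * δ) ^ 2 := by positivity
  rw [wt_nil, mul_one, ← ENNReal.div_le_iff (ENNReal.ofReal_pos.2 hpos).ne' ENNReal.ofReal_ne_top,
    ← ENNReal.ofReal_div_of_pos hpos] at hfinal
  refine le_of_eq_of_le ?_ hfinal
  congr 1
  rw [hκ]
  field_simp

end ShiftedTGL

end TGL

/-! ### The dimension formula -/

/-- The box and packing dimension of shifted triangular Gatzouras--Lalley-type carpets. Here `Λ` is
the carpet, `ΛH` the attractor of the column system, `sH` its box dimension (which exists), `sx` the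
unique solution of `∑ b_i ^ sx = 1`, and `s`, `sA` are the unique solutions of their equations. -/
theorem theorem3p4 {N M : ℕ} (F : TGL.ShiftedTGL N M)
    (Λ : Set TGL.Plane) (hΛ : TGL.IsAttractor F.map Λ)
    (ΛH : Set ℝ) (hΛH : TGL.IsAttractor F.columnMap ΛH) :
    ∃ sH sx s sA : ℝ,
      TGL.HasBoxDim ΛH sH ∧
      (∀ x : ℝ, ∑ i, F.b i ^ x = 1 ↔ x = sx) ∧
      (∀ x : ℝ, ∑ i, F.b i ^ sH * F.a i ^ (x - sH) = 1 ↔ x = s) ∧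
      (∀ x : ℝ, ∑ i, F.b i ^ min sx 1 * F.a i ^ (x - min sx 1) = 1 ↔ x = sA) ∧
      (TGL.packingDim Λ : EReal) = TGL.upperBoxDim Λ ∧
      TGL.upperBoxDim Λ ≤ (s : EReal) ∧
      s ≤ sA ∧
      (F.ROSC Λ → (TGL.packingDim Λ : EReal) = (s : EReal) ∧ TGL.HasBoxDim Λ s) := by
  have := F.nonempty_maps
  have := F.nonempty_columns
  have hIcc := F.columnAttractor_subset_Icc hΛH
  have hproj := F.image_fst_eq hΛ hΛH
  obtain ⟨sH, ⟨C, hC0, hC⟩, hlow⟩ := TGL.IsAttractor.exists_powerLaw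
    (F.columnMap_eq_lineMap ▸ hΛH) F.r_pos F.r_lt_one hIcc F.sum_r_le_one
  have hdim : TGL.HasBoxDim ΛH sH := TGL.hasBoxDim_of_powerLaw hC hlow
  obtain ⟨sx, hsx⟩ := TGL.exists_unique_exponent (α := fun _ : Fin N => (1 : ℝ))
    (fun _ => one_pos) F.b_pos F.b_lt_one 0
  simp only [one_mul, sub_zero] at hsx
  obtain ⟨s, hs⟩ := TGL.exists_unique_exponent (α := fun i => F.b i ^ sH)
    (fun i => Real.rpow_pos_of_pos (F.b_pos i) _) F.a_pos F.a_lt_one sH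
  obtain ⟨sA, hsA⟩ := TGL.exists_unique_exponent (α := fun i => F.b i ^ min sx 1)
    (fun i => Real.rpow_pos_of_pos (F.b_pos i) _) F.a_pos F.a_lt_one (min sx 1)
  have hsum : ∑ i, F.weight sH s i = 1 := (hs s).2 rfl
  have hup : TGL.upperBoxDim Λ ≤ (s : EReal) := F.upperBoxDim_le hΛ hproj hC0 hC hsum
  have hpack : (TGL.packingDim Λ : EReal) = TGL.upperBoxDim Λ :=
    TGL.packingDim_eq_upperBoxDim hΛ.2.1 hΛ.1 (F.exists_cylinder_in_ball hΛ)
  have hle : ∀ {ι : Type} [Fintype ι] [Nonempty ι] {r u : ι → ℝ},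
      TGL.IsAttractor (TGL.lineMap r u) ΛH → (∀ i, 0 < r i) → (∀ i, r i < 1) →
      ∀ x : ℝ, 0 ≤ x → ∑ i, r i ^ x ≤ 1 → sH ≤ x := by
    intro ι _ _ r u hK h0 h1 x hx hsum
    obtain ⟨C', hC'⟩ := hK.sep_le_of_sum_rpow_le_one h0 h1 hIcc hx hsum
    have h2 : TGL.upperBoxDim ΛH ≤ x :=
      TGL.upperBoxDim_le_of_cov_le (k := 1) (C := C') one_pos fun δ hδ => by
        rw [one_mul]; exact TGL.cov_le_sep.trans (hC' δ ⟨hδ.1, hδ.2.le⟩)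
    rw [hdim.2] at h2
    exact_mod_cast h2
  have hsx_sum : ∑ i, F.b i ^ sx = 1 := (hsx sx).2 rfl
  -- with a negative exponent every term of the sum would exceed one
  have hsx0 : 0 ≤ sx := by
    by_contra! hneg
    obtain ⟨j⟩ := ‹Nonempty (Fin N)›
    have h1 : F.b j ^ sx ≤ ∑ i, F.b i ^ sx := Finset.single_le_sum
      (f := fun i => F.b i ^ sx) (fun i _ => Real.rpow_nonneg (F.b_pos i).le _)
      (Finset.mem_univ j)
    have h2 := Real.one_lt_rpow_of_pos_of_lt_one_of_neg (F.b_pos j) (F.b_lt_one j) hneg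
    linarith
  have hmin : sH ≤ min sx 1 := le_min
    (hle (F.isAttractor_lineMap_b hΛH) F.b_pos F.b_lt_one sx hsx0 hsx_sum.le)
    (hle (F.columnMap_eq_lineMap ▸ hΛH) F.r_pos F.r_lt_one 1 zero_le_one
      (by simpa using F.sum_r_le_one))
  refine ⟨sH, sx, s, sA, hdim, hsx, hs, hsA, hpack, hup, ?_, fun hR => ?_⟩
  · -- at exponent `x`, the sum defining `sA` dominates the one defining `s`, as `a < b`
    by_contra! hlt
    have h1 := (hsA sA).2 rfl
    have h2 : ∑ i, F.b i ^ sH * F.a i ^ (s - sH) <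
        ∑ i, F.b i ^ min sx 1 * F.a i ^ (sA - min sx 1) := by
      refine Finset.sum_lt_sum_of_nonempty Finset.univ_nonempty fun i _ => ?_
      have ha := F.a_pos i
      have hb := F.b_pos i
      have e1 : F.b i ^ min sx 1 = F.b i ^ sH * F.b i ^ (min sx 1 - sH) := by
        rw [← Real.rpow_add hb]; ring_nf
      have e2 : F.a i ^ (sA - sH) =
          F.a i ^ (min sx 1 - sH) * F.a i ^ (sA - min sx 1) := by
        rw [← Real.rpow_add ha]; ring_nf
      have i1 : F.a i ^ (min sx 1 - sH) ≤ F.b i ^ (min sx 1 - sH) :=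
        Real.rpow_le_rpow ha.le (F.a_lt_b i).le (by linarith)
      calc F.b i ^ sH * F.a i ^ (s - sH) < F.b i ^ sH * F.a i ^ (sA - sH) := by
            refine mul_lt_mul_of_pos_left ?_ (Real.rpow_pos_of_pos hb _)
            exact Real.rpow_lt_rpow_of_exponent_gt ha (F.a_lt_one i) (by linarith)
        _ = F.b i ^ sH * F.a i ^ (min sx 1 - sH) * F.a i ^ (sA - min sx 1) := by
            rw [e2, mul_assoc]
        _ ≤ F.b i ^ sH * F.b i ^ (min sx 1 - sH) * F.a i ^ (sA - min sx 1) := by gcongr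
        _ = F.b i ^ min sx 1 * F.a i ^ (sA - min sx 1) := by rw [e1]
    have h3 := (hs s).2 rfl
    linarith
  · have hlb : (s : EReal) ≤ TGL.lowerBoxDim Λ := hR.le_lowerBoxDim hΛ hproj hIcc hlow hsum
    have hlu := TGL.lowerBoxDim_le_upperBoxDim Λ
    have hupper : TGL.upperBoxDim Λ = s := le_antisymm hup (hlb.trans hlu)
    exact ⟨hpack.trans hupper, le_antisymm (hlu.trans hup) hlb, hupper⟩
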